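/- Let $M$ be a smooth $n$-dimensional manifold, $g$ a smooth pseudo-Riemannian metric on $M$ (symmetric, nondegenerate, any signature), $A$ a smooth real 1-form, $h\neq 0$ a real constant such that $\tilde g_{\mu\nu}:=g_{\mu\nu}-\frac1h A_\mu A_\nu$ is nondegenerate everywhere, and $\rho$ a smooth, nowhere vanishing function on $M$ with imaginary values. Write $F=\mathrm dA$, $F_{\mu\nu}=\partial_\mu A_\nu-\partial_\nu A_\mu$, and let $\tilde g^{\mu\nu}$ and $\tilde\Gamma$ be the inverse and the Levi-Civita Christoffel symbols of $\tilde g$. Repeated indices are summed. On the algebra $C^\infty(M)\otimes M_2(\mathbb C)$, with Pauli matrices $\sigma^1,\sigma^2,\sigma^3$, use over each coordinate chart $x^\mu$ of $M$ the differential calculus with central basis $\mathrm dx^\mu,s^1,s^2$ of 1-forms, $\mathrm df=(\partial_\mu f)\,\mathrm dx^\mu+(\partial_i f)s^i$, where $\partial_i=\frac{\imath}{2}[\sigma^i,\cdot\,]$ for $i=1,2$. The $\mathrm dx^\mu$ anticommute with each other and with the $s^i$, while $s^1\wedge s^1=s^2\wedge s^2=\imath\,\mathrm{Vol}$, $s^1\wedge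 s^2=s^2\wedge s^1=0$, and $\mathrm d(\mathrm dx^\mu)=0$, $\mathrm ds^i=-\sigma^i\mathrm{Vol}$. The lift $i:\Omega^2\to\Omega^1\otimes\Omega^1$ is the bimodule map with $i(\mathrm dx^\mu\wedge e)=\frac12(\mathrm dx^\mu\otimes e-e\otimes\mathrm dx^\mu)$ for $e=\mathrm dx^\nu$ or $e=s^j$, and $i(\mathrm{Vol})=\frac1{2\imath}(s^1\otimes s^1+s^2\otimes s^2)$. Let $$\mathfrak g=g_{\mu\nu}\,\mathrm dx^\mu\otimes\mathrm dx^\nu+A_\mu(s^1\otimes\mathrm dx^\mu+\mathrm dx^\mu\otimes s^1)+h(s^1\otimes s^1-s^2\otimes s^2)$$ with inverse pairing $(\ ,\ )$, and let $\nabla$ be the left connection on 1-forms with $$\nabla\mathrm dx^\mu=-\Gamma^\mu_{\alpha\beta}\,\mathrm dx^\alpha\otimes\mathrm dx^\beta+B^\mu{}_\alpha(\mathrm dx^\alpha\otimes s^1+s^1\otimes\mathrm dx^\alpha),$$ $$\nabla s^1=D_{\alpha\beta}\,\mathrm dx^\alpha\otimes\mathrm dx^\beta+E_\alpha(\mathrm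 dx^\alpha\otimes s^1+s^1\otimes\mathrm dx^\alpha)+\imath\sigma^1 s^1\otimes s^1,\qquad \nabla s^2=\imath\sigma^2s^2\otimes s^2-2\rho\,\sigma^2s^1\otimes s^2,$$ where $$\Gamma^\sigma_{\mu\nu}=\tilde\Gamma^\sigma_{\mu\nu}+\tfrac1{2h}\tilde g^{\sigma\kappa}(A_\mu F_{\nu\kappa}+A_\nu F_{\mu\kappa}),\qquad B^\mu{}_\nu=\tfrac12\tilde g^{\mu\alpha}(\nabla_\alpha A_\nu-\nabla_\nu A_\alpha),$$ $$D_{\alpha\beta}=-\tfrac1{2h}(\nabla_\alpha A_\beta+\nabla_\beta A_\alpha)+\tfrac{\imath}{h^2}A_\alpha A_\beta\,\sigma^1,\qquad E_\alpha=-\tfrac1hA_\beta B^\beta{}_\alpha+\tfrac{\imath}{h}A_\alpha\,\sigma^1,$$ and $\nabla_\alpha A_\beta=\partial_\alpha A_\beta-\Gamma^\sigma_{\alpha\beta}A_\sigma$. Put $R_\nabla=(\mathrm d\otimes\mathrm{id}-\mathrm{id}\wedge\nabla)\nabla$, $\mathrm{Ricci}=((\ ,\ )\otimes\mathrm{id})(\mathrm{id}\otimes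 i\otimes\mathrm{id})(\mathrm{id}\otimes R_\nabla)\mathfrak g$ and $S=(\ ,\ )\mathrm{Ricci}$. **Theorem.** In every coordinate chart of $M$, at every point of its domain, $S$ is the multiple of $1\in M_2(\mathbb C)$ $$S=\tilde S_M+\frac{2\rho^2}{h}+\frac1{8h}\|F\|^2+\frac1{8h^2}\|A.F\|^2 ,$$ where $\tilde S_M$ is $-\frac12$ times the usual scalar curvature of $\tilde g$ (the one that is positive on round spheres), $\|F\|^2=\tilde g^{\mu\alpha}\tilde g^{\nu\beta}F_{\mu\nu}F_{\alpha\beta}$, $(A.F)_\mu=\tilde g^{\alpha\beta}A_\alpha F_{\beta\mu}$ and $\|A.F\|^2=\tilde g^{\mu\nu}(A.F)_\mu(A.F)_\nu$. -/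

import Mathlib

open scoped Manifold ContDiff Matrix

noncomputable section

namespace QKK

/-! ## Classical fields on a smooth manifold and their components in a chart -/

/-- The model space of an `n`-dimensional manifold. -/
abbrev E (n : ℕ) : Type := EuclideanSpace ℝ (Fin n)

section Fields

variable (n : ℕ) (M : Type*) [TopologicalSpace M] [ChartedSpace (E n) M]

/-- The coordinate vector field `∂/∂x^μ` of the chart `e`, at the point with coordinates `y`. -/
def coordVec {n : ℕ} {M : Type*} [TopologicalSpace M] [ChartedSpace (E n) M]
    (e : OpenPartialHomeomorph M (E n)) (y : E n) (μ : Fin n) :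
    TangentSpace (𝓡 n) (e.symm y) :=
  mfderiv (𝓡 n) (𝓡 n) e.symm y (EuclideanSpace.single μ (1 : ℝ) : E n)

/-- A smooth (pseudo-)Riemannian metric: a smooth field of symmetric nondegenerate bilinear forms
on the tangent spaces, of any signature. -/
structure Metric where
  val : ∀ x : M, LinearMap.BilinForm ℝ (TangentSpace (𝓡 n) x)
  symm : ∀ x v w, val x v w = val x w v
  nondegenerate : ∀ x, (val x).Nondegenerate
  smooth : ∀ e ∈ IsManifold.maximalAtlas (𝓡 n) ∞ M, ∀ μ ν : Fin n,
    ContDiffOn ℝ ∞ (fun y => val (e.symm y) (coordVec e y μ) (coordVec e y ν)) e.target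

/-- A smooth real 1-form. -/
structure OneForm where
  val : ∀ x : M, TangentSpace (𝓡 n) x →ₗ[ℝ] ℝ
  smooth : ∀ e ∈ IsManifold.maximalAtlas (𝓡 n) ∞ M, ∀ μ : Fin n,
    ContDiffOn ℝ ∞ (fun y => val (e.symm y) (coordVec e y μ)) e.target

variable {n M}

/-- Components `g_{μν}` of a metric in the chart `e`. -/
def Metric.comp (g : Metric n M) (e : OpenPartialHomeomorph M (E n)) (y : E n) :
    Matrix (Fin n) (Fin n) ℝ :=
  Matrix.of fun μ ν => g.val (e.symm y) (coordVec e y μ) (coordVec e y ν)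

/-- Components `A_μ` of a 1-form in the chart `e`. -/
def OneForm.comp (A : OneForm n M) (e : OpenPartialHomeomorph M (E n)) (y : E n) :
    Fin n → ℝ :=
  fun μ => A.val (e.symm y) (coordVec e y μ)

/-- The field of bilinear forms `g̃ = g - h⁻¹ A ⊗ A`. -/
def tildeForm (g : Metric n M) (A : OneForm n M) (h : ℝ) (x : M) :
    LinearMap.BilinForm ℝ (TangentSpace (𝓡 n) x) :=
  g.val x - h⁻¹ • LinearMap.BilinForm.linMulLin (A.val x) (A.val x)

end Fields

variable {n : ℕ}

/-! ## Classical tensor calculus in coordinates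

Below, `g : E n → Matrix (Fin n) (Fin n) ℝ` and `A : E n → Fin n → ℝ` are the components of a
metric and of a 1-form in local coordinates. -/

/-- Partial derivative `∂_μ f`. -/
def pd (μ : Fin n) (f : E n → ℝ) (y : E n) : ℝ :=
  fderiv ℝ f y (EuclideanSpace.single μ 1)

/-- Christoffel symbols `Γ^σ_{μν}` of the Levi-Civita connection of `g`. -/
def christoffel (g : E n → Matrix (Fin n) (Fin n) ℝ) (σ μ ν : Fin n) (y : E n) : ℝ :=
  1 / 2 * ∑ κ, (g y)⁻¹ σ κ * (pd ν (fun z => g z κ μ) y + pd μ (fun z => g z ν κ) y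
    - pd κ (fun z => g z μ ν) y)

/-- The usual Ricci tensor of `g`. -/
def classicalRicci (g : E n → Matrix (Fin n) (Fin n) ℝ) (α β : Fin n) (y : E n) : ℝ :=
  ∑ μ, (pd μ (christoffel g μ α β) y - pd α (christoffel g μ μ β) y
    + ∑ κ, (christoffel g μ μ κ y * christoffel g κ α β y
      - christoffel g μ α κ y * christoffel g κ μ β y))

/-- The usual scalar curvature of `g` (positive on round spheres). -/
def scalarCurvature (g : E n → Matrix (Fin n) (Fin n) ℝ) (y : E n) : ℝ :=
  ∑ α, ∑ β, (g y)⁻¹ α β * classicalRicci g α β y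

/-- `F_{μν} = ∂_μ A_ν - ∂_ν A_μ`, the components of `F = dA`. -/
def fieldStrength (A : E n → Fin n → ℝ) (μ ν : Fin n) (y : E n) : ℝ :=
  pd μ (fun z => A z ν) y - pd ν (fun z => A z μ) y

/-- `g̃_{μν} = g_{μν} - A_μ A_ν / h`. -/
def tildeMetric (g : E n → Matrix (Fin n) (Fin n) ℝ) (A : E n → Fin n → ℝ) (h : ℝ) (y : E n) :
    Matrix (Fin n) (Fin n) ℝ :=
  Matrix.of fun μ ν => g y μ ν - A y μ * A y ν / h

/-- `‖T‖² = g^{μα} g^{νβ} T_{μν} T_{αβ}`. -/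
def normSq₂ (g : E n → Matrix (Fin n) (Fin n) ℝ) (T : Fin n → Fin n → E n → ℝ) (y : E n) : ℝ :=
  ∑ μ, ∑ ν, ∑ α, ∑ β, (g y)⁻¹ μ α * (g y)⁻¹ ν β * T μ ν y * T α β y

/-- `‖V‖² = g^{μν} V_μ V_ν`. -/
def normSq₁ (g : E n → Matrix (Fin n) (Fin n) ℝ) (V : Fin n → E n → ℝ) (y : E n) : ℝ :=
  ∑ μ, ∑ ν, (g y)⁻¹ μ ν * V μ y * V ν y

/-- `(A.F)_μ = g^{αβ} A_α F_{βμ}`, where `F = dA`. -/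
def contractAF (g : E n → Matrix (Fin n) (Fin n) ℝ) (A : E n → Fin n → ℝ) (μ : Fin n)
    (y : E n) : ℝ :=
  ∑ α, ∑ β, (g y)⁻¹ α β * A y α * fieldStrength A β μ y

/-! ## The differential calculus on `C^∞(U) ⊗ M₂(ℂ)`, `U` a coordinate domain

The central basis of `Ω¹` consists of the `dx^μ` (index `Sum.inl μ`) and of the forms `s^1, s^2` of
`M₂(ℂ)` (indices `Sum.inr 0`, `Sum.inr 1`). -/

/-- The algebra `M₂(ℂ)`. -/
abbrev M2 : Type := Matrix (Fin 2) (Fin 2) ℂ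

/-- The Pauli matrices `σ^1` (index `0`) and `σ^2` (index `1`). -/
def pauli : Fin 2 → M2 := ![!![0, 1; 1, 0], !![0, -Complex.I; Complex.I, 0]]

/-- Elements of the coordinate algebra, as matrix valued functions of the coordinates. -/
abbrev Alg (n : ℕ) : Type := E n → M2

/-- Labels of the central basis `dx^μ, s^i` of 1-forms. -/
abbrev Ix (n : ℕ) : Type := Fin n ⊕ Fin 2

/-- `Ω¹`: the function `θ` stands for `θ_a e^a`. -/
abbrev Form1 (n : ℕ) : Type := Ix n → Alg n

/-- `Ω¹ ⊗_A Ω¹`: the function `T` stands for `T_{ab} e^a ⊗ e^b`. -/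
abbrev Form11 (n : ℕ) : Type := Ix n → Ix n → Alg n

/-- `Ω²`, where `dx^μ` and `s^i` anticommute, the `dx^μ` anticommute among themselves,
`s^1 ∧ s^1 = s^2 ∧ s^2 = ı Vol` and `s^1 ∧ s^2 = s^2 ∧ s^1 = 0`. An element stands for
`½ xx_{μν} dx^μ ∧ dx^ν + xs_{μi} dx^μ ∧ s^i + vol Vol`. -/
@[ext]
structure Form2 (n : ℕ) where
  xx : Fin n → Fin n → Alg n
  xs : Fin n → Fin 2 → Alg n
  vol : Alg n
  antisymm : ∀ μ ν, xx μ ν = -xx ν μ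

instance : Add (Form2 n) where
  add θ η :=
    { xx := fun μ ν => θ.xx μ ν + η.xx μ ν
      xs := fun μ i => θ.xs μ i + η.xs μ i
      vol := θ.vol + η.vol
      antisymm := fun μ ν => by rw [θ.antisymm μ ν, η.antisymm μ ν, neg_add] }

instance : Sub (Form2 n) where
  sub θ η :=
    { xx := fun μ ν => θ.xx μ ν - η.xx μ ν
      xs := fun μ i => θ.xs μ i - η.xs μ i
      vol := θ.vol - η.vol
      antisymm := fun μ ν => by rw [θ.antisymm μ ν, η.antisymm μ ν, neg_sub, neg_sub_neg] }

/-- A constant element `m` of `M₂(ℂ)` as an element of the product algebra. -/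
def ofM2 (m : M2) : Alg n := fun _ => m

/-- A function on spacetime as an element of the product algebra. -/
def ofFun (f : E n → ℂ) : Alg n := fun y => f y • (1 : M2)

/-- A real function on spacetime as an element of the product algebra. -/
def ofReal (f : E n → ℝ) : Alg n := ofFun fun y => (f y : ℂ)

/-- The derivations of the product algebra dual to the basis: `∂_μ` acts by differentiation of the
matrix entries, and `∂_i = (ı/2)[σ^i, ·]` is the derivation with `∂_i σ^j = -ε_{ijk} σ^k`. -/
def deriv0 (f : Alg n) : Ix n → Alg n
  | Sum.inl μ => fun y => Matrix.of fun p q =>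
      fderiv ℝ (fun z => f z p q) y (EuclideanSpace.single μ 1)
  | Sum.inr i => fun y => (Complex.I / 2) • (pauli i * f y - f y * pauli i)

/-- `d : A → Ω¹`, `df = (∂_a f) e^a`. -/
def d0 (f : Alg n) : Form1 n := fun a => deriv0 f a

/-- `∧ : Ω¹ ⊗_A Ω¹ → Ω²`. -/
def wedge (T : Form11 n) : Form2 n where
  xx := fun μ ν => T (Sum.inl μ) (Sum.inl ν) - T (Sum.inl ν) (Sum.inl μ)
  xs := fun μ i => T (Sum.inl μ) (Sum.inr i) - T (Sum.inr i) (Sum.inl μ)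
  vol := Complex.I • (T (Sum.inr 0) (Sum.inr 0) + T (Sum.inr 1) (Sum.inr 1))
  antisymm := fun _ _ => (neg_sub _ _).symm

/-- `d : Ω¹ → Ω²`, `d(θ_b e^b) = dθ_b ∧ e^b + θ_b de^b` with `d(dx^μ) = 0` and
`ds^i = -σ^i Vol`. -/
def d1 (θ : Form1 n) : Form2 n :=
  wedge (fun a b => d0 (θ b) a) +
    { xx := fun _ _ => 0
      xs := fun _ _ => 0
      vol := -∑ i, θ (Sum.inr i) * ofM2 (pauli i)
      antisymm := fun _ _ => neg_zero.symm }

/-- The lift `i : Ω² → Ω¹ ⊗_A Ω¹`: antisymmetric on `dx^μ ∧ dx^ν` and on `dx^μ ∧ s^i`, and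
`i(Vol) = (1/2ı)(s^1 ⊗ s^1 + s^2 ⊗ s^2)`. -/
def lift (θ : Form2 n) : Form11 n
  | Sum.inl μ, Sum.inl ν => (1 / 2 : ℂ) • θ.xx μ ν
  | Sum.inl μ, Sum.inr i => (1 / 2 : ℂ) • θ.xs μ i
  | Sum.inr i, Sum.inl μ => -((1 / 2 : ℂ) • θ.xs μ i)
  | Sum.inr i, Sum.inr j => if i = j then (1 / (2 * Complex.I)) • θ.vol else 0

/-! ## Connections and curvature

A left connection on `Ω¹` is given by the elements `N c = ∇e^c` of `Ω¹ ⊗_A Ω¹`. -/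

/-- `∇(θ_c e^c) = dθ_c ⊗ e^c + θ_c ∇e^c`. -/
def nabla (N : Ix n → Form11 n) (θ : Form1 n) : Form11 n :=
  fun a b => d0 (θ b) a + ∑ c, θ c * N c a b

/-- `R_∇ = (d ⊗ id - id ∧ ∇)∇ : Ω¹ → Ω² ⊗_A Ω¹`; the value at `b` is the coefficient in `Ω²`
of `⊗ e^b`. -/
def curvature (N : Ix n → Form11 n) (θ : Form1 n) : Ix n → Form2 n :=
  fun b => d1 (fun a => nabla N θ a b) -
    wedge (fun a a' => ∑ c, nabla N θ a c * N c a' b)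

/-- The basis 1-form `e^b`. -/
def basisForm (b : Ix n) : Form1 n := fun a => if a = b then 1 else 0

/-- `Ricci = (( , ) ⊗ id)(id ⊗ i ⊗ id)(id ⊗ R_∇) 𝔤`, for a metric `𝔤 = G_{ab} e^a ⊗ e^b` and the
pairing of 1-forms with `(e^a, e^b) = P^{ab}`. -/
def ricci (N : Ix n → Form11 n) (G P : Form11 n) : Form11 n :=
  fun p c => ∑ a, ∑ b, ∑ q, G a b * lift (curvature N (basisForm b) c) q p * P a q

/-- The Ricci scalar `S = ( , ) Ricci`. -/
def ricciScalar (N : Ix n → Form11 n) (G P : Form11 n) : Alg n :=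
  ∑ a, ∑ b, ricci N G P a b * P a b

/-! ## The quantum geometry determined by `g`, `A`, `h`, `ρ` -/

section Solution

variable (g : E n → Matrix (Fin n) (Fin n) ℝ) (A : E n → Fin n → ℝ) (h : ℝ) (ρ : E n → ℂ)

/-- Coefficients of `𝔤 = g_{μν} dx^μ ⊗ dx^ν + A_μ (s^1 ⊗ dx^μ + dx^μ ⊗ s^1)
+ h (s^1 ⊗ s^1 - s^2 ⊗ s^2)`. -/
def metricMatrix (y : E n) : Matrix (Ix n) (Ix n) ℝ :=
  Matrix.fromBlocks (g y) (Matrix.of fun μ i => ![A y μ, 0] i)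
    (Matrix.of fun i μ => ![A y μ, 0] i) !![h, 0; 0, -h]

/-- The quantum metric `𝔤`. -/
def quantumMetric : Form11 n := fun a b => ofReal fun y => metricMatrix g A h y a b

/-- The pairing `( , )` inverse to `𝔤`: its coefficients `(e^a, e^b)` are the entries of the inverse
of the coefficient matrix of `𝔤`. -/
def inverseMetric : Form11 n := fun a b => ofReal fun y => (metricMatrix g A h y)⁻¹ a b

/-- `Γ^σ_{μν} = Γ̃^σ_{μν} + (1/2h) g̃^{σκ}(A_μ F_{νκ} + A_ν F_{μκ})`. -/
def Gam (σ μ ν : Fin n) (y : E n) : ℝ :=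
  christoffel (tildeMetric g A h) σ μ ν y +
    1 / (2 * h) * ∑ κ, (tildeMetric g A h y)⁻¹ σ κ *
      (A y μ * fieldStrength A ν κ y + A y ν * fieldStrength A μ κ y)

/-- `∇_α A_β`, the covariant derivative for the symbols `Γ`. -/
def covA (α β : Fin n) (y : E n) : ℝ :=
  pd α (fun z => A z β) y - ∑ σ, Gam g A h σ α β y * A y σ

/-- `B^μ_ν = ½ g̃^{μα}(∇_α A_ν - ∇_ν A_α)`. -/
def Bf (μ ν : Fin n) (y : E n) : ℝ :=
  1 / 2 * ∑ α, (tildeMetric g A h y)⁻¹ μ α * (covA g A h α ν y - covA g A h ν α y)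

/-- `D_{αβ} = -(1/2h)(∇_α A_β + ∇_β A_α) + (ı/h²) A_α A_β σ^1`. -/
def Df (α β : Fin n) : Alg n :=
  ofReal (fun y => -(1 / (2 * h)) * (covA g A h α β y + covA g A h β α y)) +
    ofFun (fun y => Complex.I / (h : ℂ) ^ 2 * (A y α : ℂ) * (A y β : ℂ)) * ofM2 (pauli 0)

/-- `E_α = -(1/h) A_β B^β_α + (ı/h) A_α σ^1`. -/
def Ef (α : Fin n) : Alg n :=
  ofReal (fun y => -(1 / h) * ∑ β, A y β * Bf g A h β α y) +
    ofFun (fun y => Complex.I / (h : ℂ) * (A y α : ℂ)) * ofM2 (pauli 0)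

/-- The connection of the `A_μ` solution:
`∇dx^μ = -Γ^μ_{αβ} dx^α ⊗ dx^β + B^μ_α (dx^α ⊗ s^1 + s^1 ⊗ dx^α)`,
`∇s^1 = D_{αβ} dx^α ⊗ dx^β + E_α (dx^α ⊗ s^1 + s^1 ⊗ dx^α) + ı σ^1 s^1 ⊗ s^1`,
`∇s^2 = ı σ^2 s^2 ⊗ s^2 - 2 ρ σ^2 s^1 ⊗ s^2`. -/
def connection : Ix n → Form11 n
  | Sum.inl μ, Sum.inl α, Sum.inl β => ofReal fun y => -Gam g A h μ α β y
  | Sum.inl μ, Sum.inl α, Sum.inr i => if i = 0 then ofReal (Bf g A h μ α) else 0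
  | Sum.inl μ, Sum.inr i, Sum.inl α => if i = 0 then ofReal (Bf g A h μ α) else 0
  | Sum.inl _, Sum.inr _, Sum.inr _ => 0
  | Sum.inr 0, Sum.inl α, Sum.inl β => Df g A h α β
  | Sum.inr 0, Sum.inl α, Sum.inr i => if i = 0 then Ef g A h α else 0
  | Sum.inr 0, Sum.inr i, Sum.inl α => if i = 0 then Ef g A h α else 0
  | Sum.inr 0, Sum.inr i, Sum.inr j =>
      if i = 0 ∧ j = 0 then ofM2 (Complex.I • pauli 0) else 0
  | Sum.inr 1, Sum.inl _, _ => 0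
  | Sum.inr 1, Sum.inr _, Sum.inl _ => 0
  | Sum.inr 1, Sum.inr i, Sum.inr j =>
      if j = 1 then
        (if i = 1 then ofM2 (Complex.I • pauli 1)
          else ofFun (fun y => -2 * ρ y) * ofM2 (pauli 1))
      else 0

/-- The Ricci scalar of the quantum geometry `(𝔤, ∇)` on the product algebra. -/
def productRicciScalar : Alg n :=
  ricciScalar (connection g A h ρ) (quantumMetric g A h) (inverseMetric g A h)

end Solution

end QKK

end

/-! The computation simplifies in the frame `dx^μ, ω, s^2` with `ω = s^1 + h⁻¹ A_μ dx^μ`, in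
Kaluza-Klein fashion. Completing the square turns `𝔤` into `g̃ + h (ω ⊗ ω - s^2 ⊗ s^2)`, block
diagonal (`metricMatrix_eq`). The symmetric symbols `Γ` drop out of the antisymmetrized `∇A`, so `B
= ½ g̃⁻¹ F` (`bf_eq`), and the `A F` correction in `Γ` is exactly what rewriting `dx ⊗ ω + ω ⊗ dx`
in terms of `s^1` produces (`neg_gam_eq`). Hence the connection becomes `adaptedConn`: Levi-Civita
symbols of `g̃`, plus terms in `F` and the constant and `ρ` terms along `ω` and `s^2`.

The change of frame is `1 + K` with `K² = 0` and real, hence central, entries. It commutes with the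
Pauli matrices, and the inner derivations `∂_i` vanish on it, so the connection transforms with an
inhomogeneous term only along `dx^μ` (`connMat_inl_eq`, `connMat_inr_eq`) and the lifted curvature
is conjugated (`liftMat_eq_of_gauge`). Only the upper leg and the last leg of the curvature are
moved to the new frame in this way; the two legs created by the lift stay in `dx^μ, s^i`, and the
factors `1 - K` in `sum_smul_conj` account for them.

The contraction then has four sources. The `dx`-block gives `-½` times the classical scalar
curvature of `g̃`: the sign comes from `∇dx = -Γ`, the `½` from the lift. All derivatives of `B`
cancel, and `∂_μ k_ν - ∂_ν k_μ = F_{μν}/h` for `k = A/h` leaves terms of type `F B` and `B B`, which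
add up to `‖F‖²/(8h)` (`real_frame_sum`, `quadratic_contraction`), and a term `k k B B`, which gives
`‖A.F‖²/(8h²)` (`quartic_contraction`). The `s^2` direction gives `2ρ²/h`
(`liftMat_adaptedConn_s₂s₂`). The remaining `σ^1` terms pair an antisymmetric tensor with a
symmetric one and vanish (`sum_mul_antisymm`), so `S` is a multiple of the identity. -/

noncomputable section

namespace QKK

/-! ### Components in a chart: smoothness and nondegeneracy. -/

section Chart

variable {n : ℕ} {M : Type*} [TopologicalSpace M] [ChartedSpace (E n) M]

theorem bijective_mfderiv_chart_symm {e : OpenPartialHomeomorph M (E n)}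
    (he : e ∈ IsManifold.maximalAtlas (𝓡 n) ∞ M) {y : E n} (hy : y ∈ e.target) :
    Function.Bijective (mfderiv (𝓡 n) (𝓡 n) e.symm y) := by
  have hd : e.MDifferentiable (𝓡 n) (𝓡 n) :=
    ⟨(contMDiffOn_of_mem_maximalAtlas he).mdifferentiableOn (by simp),
      (contMDiffOn_symm_of_mem_maximalAtlas he).mdifferentiableOn (by simp)⟩
  exact hd.symm.mfderiv_bijective hy

/-- The coordinate vector fields form a basis of the tangent space. -/
theorem exists_basis_coordVec {e : OpenPartialHomeomorph M (E n)}
    (he : e ∈ IsManifold.maximalAtlas (𝓡 n) ∞ M) {y : E n} (hy : y ∈ e.target) :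
    ∃ b : Module.Basis (Fin n) ℝ (TangentSpace (𝓡 n) (e.symm y)), ∀ μ, b μ = coordVec e y μ := by
  let L : E n ≃ₗ[ℝ] TangentSpace (𝓡 n) (e.symm y) :=
    LinearEquiv.ofBijective (mfderiv (𝓡 n) (𝓡 n) e.symm y).toLinearMap
      (bijective_mfderiv_chart_symm he hy)
  refine ⟨(EuclideanSpace.basisFun (Fin n) ℝ).toBasis.map L, fun μ => ?_⟩
  have h1 : (EuclideanSpace.basisFun (Fin n) ℝ).toBasis μ = EuclideanSpace.single μ 1 := by simp
  rw [Module.Basis.map_apply, h1]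
  rfl

/-- The component matrix is the Gram matrix of `tildeForm` in the basis of coordinate vectors, so
nondegeneracy of the form is nonvanishing of its determinant. -/
theorem det_tildeMetric_ne_zero (g : Metric n M) (A : OneForm n M) (h : ℝ)
    (htilde : ∀ x : M, (tildeForm g A h x).Nondegenerate)
    {e : OpenPartialHomeomorph M (E n)} (he : e ∈ IsManifold.maximalAtlas (𝓡 n) ∞ M)
    {y : E n} (hy : y ∈ e.target) :
    (tildeMetric (g.comp e) (A.comp e) h y).det ≠ 0 := by
  obtain ⟨b, hb⟩ := exists_basis_coordVec he hy
  have h1 := (LinearMap.BilinForm.nondegenerate_iff_det_ne_zero b).1 (htilde (e.symm y))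
  convert h1 using 2
  ext μ ν
  simp [tildeMetric, Metric.comp, OneForm.comp, LinearMap.BilinForm.toMatrix_apply, hb, tildeForm]
  ring

theorem contDiffAt_metric_comp (g : Metric n M)
    {e : OpenPartialHomeomorph M (E n)} (he : e ∈ IsManifold.maximalAtlas (𝓡 n) ∞ M)
    {y : E n} (hy : y ∈ e.target) (μ ν : Fin n) :
    ContDiffAt ℝ ∞ (fun z => g.comp e z μ ν) y :=
  (g.smooth e he μ ν).contDiffAt (e.open_target.mem_nhds hy)

theorem contDiffAt_oneForm_comp (A : OneForm n M)
    {e : OpenPartialHomeomorph M (E n)} (he : e ∈ IsManifold.maximalAtlas (𝓡 n) ∞ M)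
    {y : E n} (hy : y ∈ e.target) (μ : Fin n) :
    ContDiffAt ℝ ∞ (fun z => A.comp e z μ) y :=
  (A.smooth e he μ).contDiffAt (e.open_target.mem_nhds hy)

theorem differentiableAt_comp_chart_symm {ρ : M → ℂ} (hρ : ContMDiff (𝓡 n) 𝓘(ℝ, ℂ) ∞ ρ)
    {e : OpenPartialHomeomorph M (E n)} (he : e ∈ IsManifold.maximalAtlas (𝓡 n) ∞ M)
    {y : E n} (hy : y ∈ e.target) :
    DifferentiableAt ℝ (fun z => ρ (e.symm z)) y := by
  have h1 := (hρ _).comp y (contMDiffAt_symm_of_mem_maximalAtlas he hy)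
  exact (contMDiffAt_iff_contDiffAt.1 h1).differentiableAt (by simp)

end Chart

variable {n : ℕ}

/-! ## Connections as matrices over `M₂(ℂ)` -/

/-- Square matrices over `M₂(ℂ)` indexed by the basis of 1-forms. -/
abbrev FrameMat (n : ℕ) : Type := Matrix (Ix n) (Ix n) M2

/-- Entrywise differentiability at a point. -/
def DiffMatAt (X : E n → FrameMat n) (y : E n) : Prop :=
  ∀ b c p q, DifferentiableAt ℝ (fun z => X z b c p q) y

/-- Entrywise application of the derivations of the product algebra. -/
def dMat (X : E n → FrameMat n) (a : Ix n) (y : E n) : FrameMat n :=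
  Matrix.of fun b c => deriv0 (fun z => X z b c) a y

/-- The scalar matrix `σ^i`. -/
def pauliScalar (n : ℕ) (i : Fin 2) : FrameMat n := Matrix.diagonal fun _ => pauli i

/-- In the `s^i` directions the derivation is inner, so it becomes a commutator of frame matrices
and needs no differentiability. -/
theorem dMat_inr (X : E n → FrameMat n) (i : Fin 2) (y : E n) :
    dMat X (Sum.inr i) y =
      (Complex.I / 2) • (pauliScalar n i * X y - X y * pauliScalar n i) := by
  ext1 b c
  simp [dMat, deriv0, pauliScalar]

theorem DiffMatAt.sub {X Y : E n → FrameMat n} {y : E n} (hX : DiffMatAt X y)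
    (hY : DiffMatAt Y y) : DiffMatAt (fun z => X z - Y z) y := fun b c p q =>
  (hX b c p q).sub (hY b c p q)

theorem DiffMatAt.add {X Y : E n → FrameMat n} {y : E n} (hX : DiffMatAt X y)
    (hY : DiffMatAt Y y) : DiffMatAt (fun z => X z + Y z) y := fun b c p q =>
  (hX b c p q).add (hY b c p q)

theorem diffMatAt_const (X : FrameMat n) (y : E n) : DiffMatAt (fun _ => X) y :=
  fun _ _ _ _ => differentiableAt_const _

theorem DiffMatAt.mul {X Y : E n → FrameMat n} {y : E n} (hX : DiffMatAt X y)
    (hY : DiffMatAt Y y) : DiffMatAt (fun z => X z * Y z) y := by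
  intro b c p q
  simp only [Matrix.mul_apply, Matrix.sum_apply]
  exact DifferentiableAt.fun_sum fun d _ => DifferentiableAt.fun_sum fun r _ =>
    (hX b d p r).mul (hY d c r q)

theorem dMat_inl_add {X Y : E n → FrameMat n} {y : E n} (hX : DiffMatAt X y)
    (hY : DiffMatAt Y y) (μ : Fin n) :
    dMat (fun z => X z + Y z) (Sum.inl μ) y = dMat X (Sum.inl μ) y + dMat Y (Sum.inl μ) y := by
  ext b c p q
  simp [dMat, deriv0, fderiv_fun_add (hX b c p q) (hY b c p q)]

theorem dMat_inl_sub {X Y : E n → FrameMat n} {y : E n} (hX : DiffMatAt X y)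
    (hY : DiffMatAt Y y) (μ : Fin n) :
    dMat (fun z => X z - Y z) (Sum.inl μ) y = dMat X (Sum.inl μ) y - dMat Y (Sum.inl μ) y := by
  ext b c p q
  simp [dMat, deriv0, fderiv_fun_sub (hX b c p q) (hY b c p q)]

theorem dMat_inl_const (X : FrameMat n) (μ : Fin n) (y : E n) :
    dMat (fun _ => X) (Sum.inl μ) y = 0 := by
  ext b c p q
  simp [dMat, deriv0]

theorem dMat_inl_mul {X Y : E n → FrameMat n} {y : E n} (hX : DiffMatAt X y)
    (hY : DiffMatAt Y y) (μ : Fin n) :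
    dMat (fun z => X z * Y z) (Sum.inl μ) y =
      dMat X (Sum.inl μ) y * Y y + X y * dMat Y (Sum.inl μ) y := by
  ext b c p q
  simp only [dMat, deriv0, Matrix.add_apply, Matrix.mul_apply, Matrix.sum_apply, Matrix.of_apply]
  have hm : ∀ d r, DifferentiableAt ℝ (fun z => X z b d p r * Y z d c r q) y := fun d r =>
    (hX b d p r).mul (hY d c r q)
  rw [fderiv_fun_sum fun d _ => DifferentiableAt.fun_sum fun r _ => hm d r,
    _root_.sum_apply, ← Finset.sum_add_distrib]
  refine Finset.sum_congr rfl fun d _ => ?_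
  rw [fderiv_fun_sum fun r _ => hm d r, _root_.sum_apply, ← Finset.sum_add_distrib]
  refine Finset.sum_congr rfl fun r _ => ?_
  rw [fderiv_fun_mul (hX b d p r) (hY d c r q)]
  simp
  ring

/-! ### Lifted curvature as a matrix, and its behaviour under change of frame. -/

/-- `∂_a N_{a'} - N_a N_{a'}`, whose antisymmetric part is the curvature. -/
def halfCurv (N : Ix n → E n → FrameMat n) (a a' : Ix n) (y : E n) : FrameMat n :=
  dMat (N a') a y - N a y * N a' y

/-- The coefficient of `e^q ⊗ e^p` in the lifted curvature, as a matrix over `M₂(ℂ)`. -/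
def liftMat (N : Ix n → E n → FrameMat n) (y : E n) : Ix n → Ix n → FrameMat n
  | Sum.inl μ, Sum.inl ν => (1 / 2 : ℂ) •
      (halfCurv N (Sum.inl μ) (Sum.inl ν) y - halfCurv N (Sum.inl ν) (Sum.inl μ) y)
  | Sum.inl μ, Sum.inr i => (1 / 2 : ℂ) •
      (halfCurv N (Sum.inl μ) (Sum.inr i) y - halfCurv N (Sum.inr i) (Sum.inl μ) y)
  | Sum.inr i, Sum.inl μ => -((1 / 2 : ℂ) •
      (halfCurv N (Sum.inl μ) (Sum.inr i) y - halfCurv N (Sum.inr i) (Sum.inl μ) y))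
  | Sum.inr i, Sum.inr j => if i = j then
      (1 / 2 : ℂ) • (∑ k, halfCurv N (Sum.inr k) (Sum.inr k) y) -
        (1 / (2 * Complex.I)) • ∑ k, N (Sum.inr k) y * pauliScalar n k else 0

/-- The matrices `(N_a)^b_c` of a connection. -/
def connMat (N : Ix n → Form11 n) (a : Ix n) (y : E n) : FrameMat n :=
  Matrix.of fun b c => N b a c y

theorem deriv0_basisForm (a b c : Ix n) : deriv0 (basisForm b c) a = 0 := by
  have h1 : ∃ m : ℂ, (basisForm b c : Alg n) = fun _ => m • (1 : M2) := by
    by_cases h : c = b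
    · exact ⟨1, by simp [basisForm, h]; rfl⟩
    · exact ⟨0, by simp [basisForm, h]; rfl⟩
  obtain ⟨m, hm⟩ := h1
  rw [hm]
  rcases a with μ | i
  · funext y
    ext p q
    simp [deriv0]
  · funext y
    simp [deriv0]

theorem nabla_basisForm (N : Ix n → Form11 n) (b : Ix n) :
    nabla N (basisForm b) = N b := by
  funext a c
  simp only [nabla, d0, deriv0_basisForm, zero_add]
  simp [basisForm]

/-- Reduces the form calculus to matrix algebra: on basis forms the curvature is `dN - N ∧ N`, with
`N` a matrix of 1-forms, and the extra term of `liftMat` on the `s`-block is the lift of `ds^i =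
-σ^i Vol`. -/
theorem lift_curvature_apply (N : Ix n → Form11 n) (b c q p : Ix n) (y : E n) :
    lift (curvature N (basisForm b) c) q p y = liftMat (connMat N) y q p b c := by
  have hxx : ∀ θ η : Form2 n, (θ - η).xx = fun μ ν => θ.xx μ ν - η.xx μ ν := fun _ _ => rfl
  have hxs : ∀ θ η : Form2 n, (θ - η).xs = fun μ ν => θ.xs μ ν - η.xs μ ν := fun _ _ => rfl
  have hv : ∀ θ η : Form2 n, (θ - η).vol = θ.vol - η.vol := fun _ _ => rfl
  have hxx' : ∀ θ η : Form2 n, (θ + η).xx = fun μ ν => θ.xx μ ν + η.xx μ ν := fun _ _ => rfl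
  have hxs' : ∀ θ η : Form2 n, (θ + η).xs = fun μ ν => θ.xs μ ν + η.xs μ ν := fun _ _ => rfl
  have hv' : ∀ θ η : Form2 n, (θ + η).vol = θ.vol + η.vol := fun _ _ => rfl
  have hW : ∀ a a', halfCurv (connMat N) a a' y b c =
      deriv0 (N b a' c) a y - (∑ d, N b a d * N d a' c) y := by
    intro a a'
    simp only [halfCurv, Matrix.sub_apply, Matrix.mul_apply, dMat, connMat, Matrix.of_apply,
      Finset.sum_apply, Pi.mul_apply]
  simp only [curvature, nabla_basisForm, d1]
  rcases q with μ | i <;> rcases p with ν | j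
  · simp only [lift, hxx, hxx', wedge, liftMat, Matrix.smul_apply, Matrix.sub_apply, hW, d0,
      add_zero, Pi.smul_apply, Pi.sub_apply]
    congr 1; abel
  · simp only [lift, hxs, hxs', wedge, liftMat, Matrix.smul_apply, Matrix.sub_apply, hW, d0,
      add_zero, Pi.smul_apply, Pi.sub_apply]
    congr 1; abel
  · simp only [lift, hxs, hxs', wedge, liftMat, Matrix.smul_apply, Matrix.sub_apply, hW, d0,
      add_zero, Pi.smul_apply, Pi.sub_apply, Matrix.neg_apply, Pi.neg_apply]
    congr 2; abel
  · simp only [lift, liftMat]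
    split_ifs with h
    · have h2 : ∀ k, (connMat N (Sum.inr k) y * pauliScalar n k) b c
          = (N b (Sum.inr k) c * ofM2 (pauli k) : Alg n) y := by
        intro k
        simp [pauliScalar, connMat, ofM2]
      simp only [hv, hv', wedge, Matrix.smul_apply, Matrix.sub_apply, Fin.sum_univ_two,
        Matrix.add_apply, hW, d0, Pi.smul_apply, Pi.sub_apply, Pi.add_apply, h2, Pi.neg_apply]
      have h3 : (1 / (2 * Complex.I)) * Complex.I = 1 / 2 := by
        field_simp
      simp only [smul_sub, smul_add, smul_smul, h3, smul_neg]
      abel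
    · rfl

/-- Before antisymmetrization the curvature expression is not covariant, but its defect is symmetric
in `μ, ν` once second derivatives of `K` commute, so it disappears from the curvature. -/
theorem halfCurv_eq_of_gauge {N M : Ix n → E n → FrameMat n} {K : E n → FrameMat n}
    {y : E n} (hM : ∀ a, DiffMatAt (M a) y) (hK : DiffMatAt K y)
    (hdK : ∀ μ, DiffMatAt (dMat K (Sum.inl μ)) y)
    (hN₁ : ∀ μ, N (Sum.inl μ) =
      fun z => (1 - K z) * M (Sum.inl μ) z * (1 + K z) - dMat K (Sum.inl μ) z)
    (hKK : K y * K y = 0) (hKd : ∀ μ, K y * dMat K (Sum.inl μ) y = 0)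
    (hdK' : ∀ μ, dMat K (Sum.inl μ) y * K y = 0)
    (hdd : ∀ μ ν, dMat K (Sum.inl μ) y * dMat K (Sum.inl ν) y = 0) (μ ν : Fin n) :
    halfCurv N (Sum.inl μ) (Sum.inl ν) y =
      (1 - K y) * halfCurv M (Sum.inl μ) (Sum.inl ν) y * (1 + K y)
      + (1 - K y) * (M (Sum.inl ν) y * dMat K (Sum.inl μ) y + M (Sum.inl μ) y * dMat K (Sum.inl ν) y)
      - dMat (dMat K (Sum.inl ν)) (Sum.inl μ) y := by
  have hU := (diffMatAt_const 1 y).add hK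
  have hV := (diffMatAt_const 1 y).sub hK
  simp only [halfCurv]
  rw [hN₁, hN₁, dMat_inl_sub ((hV.mul (hM _)).mul hU) (hdK ν), dMat_inl_mul (hV.mul (hM _)) hU,
    dMat_inl_mul hV (hM _), dMat_inl_add (diffMatAt_const 1 y) hK,
    dMat_inl_sub (diffMatAt_const 1 y) hK, dMat_inl_const]
  beta_reduce
  generalize dMat (M (Sum.inl ν)) (Sum.inl μ) y = dM
  generalize dMat (dMat K (Sum.inl ν)) (Sum.inl μ) y = ddK
  have hμ := hdK' μ
  have hν := hKd ν
  have hμν := hdd μ ν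
  generalize dMat K (Sum.inl ν) y = Kν at *
  generalize dMat K (Sum.inl μ) y = Kμ at *
  generalize M (Sum.inl μ) y = Mμ
  generalize M (Sum.inl ν) y = Mν
  generalize K y = k at *
  -- Grouped so that `K` and its derivatives meet only in the products `K²`, `K ∂K`, `∂K K`, `∂K
  -- ∂K`, all of which vanish.
  have h1 : ((1 - k) * Mμ * (1 + k) - Kμ) * ((1 - k) * Mν * (1 + k) - Kν) =
      (1 - k) * Mμ * (1 - k * k) * Mν * (1 + k) - (1 - k) * Mμ * (Kν + k * Kν)
        - (Kμ - Kμ * k) * Mν * (1 + k) + Kμ * Kν := by noncomm_ring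
  rw [h1, hKK, hν, hμ, hμν]
  noncomm_ring

theorem dMat_inr_conj {X : E n → FrameMat n} {y : E n} {i : Fin 2} {V U : FrameMat n}
    (hV : pauliScalar n i * V = V * pauliScalar n i)
    (hU : pauliScalar n i * U = U * pauliScalar n i) :
    (Complex.I / 2) • (pauliScalar n i * (V * X y * U) - V * X y * U * pauliScalar n i) =
      V * dMat X (Sum.inr i) y * U := by
  have h1 : pauliScalar n i * (V * X y * U) = V * (pauliScalar n i * X y) * U := by
    rw [← mul_assoc, ← mul_assoc, hV]; noncomm_ring
  have h2 : V * X y * U * pauliScalar n i = V * (X y * pauliScalar n i) * U := by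
    rw [mul_assoc, ← hU]; noncomm_ring
  rw [dMat_inr, h1, h2, ← sub_mul, ← mul_sub]
  simp only [mul_smul_comm, smul_mul_assoc]

/-- Invariance of the lifted curvature under the unipotent change of frame `1 + K`. -/
theorem liftMat_eq_of_gauge {N M : Ix n → E n → FrameMat n} {K : E n → FrameMat n}
    {y : E n} (hM : ∀ a, DiffMatAt (M a) y) (hK : DiffMatAt K y)
    (hdK : ∀ μ, DiffMatAt (dMat K (Sum.inl μ)) y)
    (hN₁ : ∀ μ, N (Sum.inl μ) =
      fun z => (1 - K z) * M (Sum.inl μ) z * (1 + K z) - dMat K (Sum.inl μ) z)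
    (hN₂ : ∀ i, N (Sum.inr i) = fun z => (1 - K z) * M (Sum.inr i) z * (1 + K z))
    (hKK : K y * K y = 0) (hKd : ∀ μ, K y * dMat K (Sum.inl μ) y = 0)
    (hdK' : ∀ μ, dMat K (Sum.inl μ) y * K y = 0)
    (hdd : ∀ μ ν, dMat K (Sum.inl μ) y * dMat K (Sum.inl ν) y = 0)
    (hsymm : ∀ μ ν, dMat (dMat K (Sum.inl ν)) (Sum.inl μ) y =
      dMat (dMat K (Sum.inl μ)) (Sum.inl ν) y)
    (hSK : ∀ i, pauliScalar n i * K y = K y * pauliScalar n i)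
    (hSdK : ∀ i μ, pauliScalar n i * dMat K (Sum.inl μ) y =
      dMat K (Sum.inl μ) y * pauliScalar n i) (q p : Ix n) :
    liftMat N y q p = (1 - K y) * liftMat M y q p * (1 + K y) := by
  have hSU : ∀ i, pauliScalar n i * (1 + K y) = (1 + K y) * pauliScalar n i := fun i => by
    rw [mul_add, add_mul, hSK, mul_one, one_mul]
  have hSV : ∀ i, pauliScalar n i * (1 - K y) = (1 - K y) * pauliScalar n i := fun i => by
    rw [mul_sub, sub_mul, hSK, mul_one, one_mul]
  have hxs : ∀ μ i, halfCurv N (Sum.inl μ) (Sum.inr i) y -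
      halfCurv N (Sum.inr i) (Sum.inl μ) y = (1 - K y) * (halfCurv M (Sum.inl μ) (Sum.inr i) y -
      halfCurv M (Sum.inr i) (Sum.inl μ) y) * (1 + K y) := by
    intro μ i
    have hU := (diffMatAt_const 1 y).add hK
    have hV := (diffMatAt_const 1 y).sub hK
    -- The inhomogeneous term `∂_μ K` commutes with `σ^i`, so the inner derivation does not see it.
    have hz : (Complex.I / 2) • (pauliScalar n i *
        ((1 - K y) * M (Sum.inl μ) y * (1 + K y) - dMat K (Sum.inl μ) y) -
        ((1 - K y) * M (Sum.inl μ) y * (1 + K y) - dMat K (Sum.inl μ) y) * pauliScalar n i) =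
        (1 - K y) * dMat (M (Sum.inl μ)) (Sum.inr i) y * (1 + K y) := by
      rw [← dMat_inr_conj (hSV i) (hSU i)]
      generalize (1 - K y) * M (Sum.inl μ) y * (1 + K y) = Z
      rw [mul_sub, sub_mul, hSdK]
      congr 1
      abel
    simp only [halfCurv]
    rw [dMat_inr, hN₁, hN₂]
    beta_reduce
    rw [hz, dMat_inl_mul (hV.mul (hM _)) hU,
      dMat_inl_mul hV (hM _), dMat_inl_add (diffMatAt_const 1 y) hK,
      dMat_inl_sub (diffMatAt_const 1 y) hK, dMat_inl_const]
    generalize dMat (M (Sum.inr i)) (Sum.inl μ) y = dM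
    generalize dMat (M (Sum.inl μ)) (Sum.inr i) y = dM'
    have hμ := hdK' μ
    have hν := hKd μ
    generalize dMat K (Sum.inl μ) y = Kμ at *
    generalize M (Sum.inl μ) y = Mμ
    generalize M (Sum.inr i) y = Mi
    generalize K y = k at *
    have h1 : ((1 - k) * Mμ * (1 + k) - Kμ) * ((1 - k) * Mi * (1 + k)) =
        (1 - k) * Mμ * (1 - k * k) * Mi * (1 + k) - (Kμ - Kμ * k) * Mi * (1 + k) := by
      noncomm_ring
    have h2 : ((1 - k) * Mi * (1 + k)) * ((1 - k) * Mμ * (1 + k) - Kμ) =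
        (1 - k) * Mi * (1 - k * k) * Mμ * (1 + k) - (1 - k) * Mi * (Kμ + k * Kμ) := by
      noncomm_ring
    rw [h1, h2, hKK, hν, hμ]
    noncomm_ring
  rcases q with μ | i <;> rcases p with ν | j
  · simp only [liftMat, mul_smul_comm, smul_mul_assoc]
    congr 1
    -- The symmetric defects of the two orderings cancel after `hsymm` identifies the second
    -- derivatives.
    rw [halfCurv_eq_of_gauge hM hK hdK hN₁ hKK hKd hdK' hdd,
      halfCurv_eq_of_gauge hM hK hdK hN₁ hKK hKd hdK' hdd, hsymm μ ν]
    noncomm_ring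
  · simp only [liftMat, mul_smul_comm, smul_mul_assoc, hxs]
  · simp only [liftMat, mul_smul_comm, smul_mul_assoc, hxs, mul_neg, neg_mul]
  · simp only [liftMat]
    split_ifs with h
    · have h1 : ∀ k, halfCurv N (Sum.inr k) (Sum.inr k) y =
          (1 - K y) * halfCurv M (Sum.inr k) (Sum.inr k) y * (1 + K y) := by
        intro k
        have h3 : ((1 - K y) * M (Sum.inr k) y * (1 + K y)) *
            ((1 - K y) * M (Sum.inr k) y * (1 + K y)) = (1 - K y) * M (Sum.inr k) y *
              (1 - K y * K y) * M (Sum.inr k) y * (1 + K y) := by noncomm_ring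
        simp only [halfCurv]
        rw [dMat_inr, hN₂]
        beta_reduce
        rw [dMat_inr_conj (hSV k) (hSU k), h3, hKK]
        noncomm_ring
      have h2 : ∀ k, N (Sum.inr k) y * pauliScalar n k =
          (1 - K y) * (M (Sum.inr k) y * pauliScalar n k) * (1 + K y) := by
        intro k
        rw [hN₂]
        beta_reduce
        rw [mul_assoc, ← hSU]
        noncomm_ring
      simp only [h1, h2, mul_sub, sub_mul, mul_smul_comm, smul_mul_assoc, Finset.mul_sum,
        Finset.sum_mul]
    · simp

/-! ## The Ricci scalar in terms of the lifted curvature -/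

/-- A real matrix as a matrix over `M₂(ℂ)`. -/
def realMat (X : Matrix (Ix n) (Ix n) ℝ) : FrameMat n :=
  Matrix.of fun b c => ((X b c : ℝ) : ℂ) • (1 : M2)

theorem realMat_mul (X Y : Matrix (Ix n) (Ix n) ℝ) : realMat X * realMat Y = realMat (X * Y) := by
  ext1 b c
  simp only [realMat, Matrix.mul_apply, Matrix.of_apply, smul_mul_smul_comm, mul_one,
    ← Finset.sum_smul, ← Complex.ofReal_mul, ← Complex.ofReal_sum]

theorem realMat_zero : realMat (0 : Matrix (Ix n) (Ix n) ℝ) = 0 := by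
  ext1 b c
  simp [realMat]

theorem realMat_one : realMat (1 : Matrix (Ix n) (Ix n) ℝ) = 1 := by
  ext1 b c
  by_cases h : b = c <;> simp [realMat, Matrix.one_apply, h]

theorem realMat_add (X Y : Matrix (Ix n) (Ix n) ℝ) : realMat (X + Y) = realMat X + realMat Y := by
  ext1 b c
  simp [realMat, add_smul]

theorem realMat_sub (X Y : Matrix (Ix n) (Ix n) ℝ) : realMat (X - Y) = realMat X - realMat Y := by
  ext1 b c
  simp [realMat, sub_smul]

theorem pauliScalar_mul_realMat (i : Fin 2) (X : Matrix (Ix n) (Ix n) ℝ) :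
    pauliScalar n i * realMat X = realMat X * pauliScalar n i := by
  ext1 b c
  simp [pauliScalar, realMat]

/-- Since the pairing inverts the metric, contracting `𝔤` against the first lifted leg is a plain
trace over `b`; the metric survives only in the final pairing. -/
theorem ricciScalar_apply (N : Ix n → Form11 n) (G P : E n → Matrix (Ix n) (Ix n) ℝ) (y : E n)
    (hGP : (G y)ᵀ * P y = 1) :
    ricciScalar N (fun a b => ofReal fun z => G z a b) (fun a b => ofReal fun z => P z a b) y =
      ∑ p, ∑ c, ((P y p c : ℝ) : ℂ) • ∑ b, liftMat (connMat N) y b p b c := by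
  have h1 : ∀ p c, ricci N (fun a b => ofReal fun z => G z a b)
      (fun a b => ofReal fun z => P z a b) p c y = ∑ b, liftMat (connMat N) y b p b c := by
    intro p c
    have h2 : ∀ b q, ∑ a, G y a b * P y a q = if b = q then 1 else 0 := by
      intro b q
      have := congrFun (congrFun hGP b) q
      simpa [Matrix.mul_apply, Matrix.one_apply] using this
    simp only [ricci, Finset.sum_apply, Pi.mul_apply, ofReal, ofFun, lift_curvature_apply,
      smul_mul_assoc, one_mul, mul_smul_comm, mul_one, smul_smul, ← Complex.ofReal_mul]
    rw [Finset.sum_comm]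
    refine Finset.sum_congr rfl fun b _ => ?_
    rw [Finset.sum_comm]
    simp_rw [← Finset.sum_smul, ← Complex.ofReal_sum, mul_comm (P y _ _), h2]
    simp
  simp only [ricciScalar, Finset.sum_apply, Pi.mul_apply, h1]
  simp only [ofReal, ofFun, mul_smul_comm, mul_one]

/-- Contraction after the change of frame `1 + k`, in which the inverse metric becomes diagonal in blocks. -/
theorem sum_smul_conj (k P D' : Matrix (Ix n) (Ix n) ℝ) (L : Ix n → Ix n → FrameMat n)
    (hP : P * (1 + k)ᵀ = (1 - k) * D') :
    ∑ p, ∑ c, ((P p c : ℝ) : ℂ) • ∑ b, ((1 - realMat k) * L b p * (1 + realMat k)) b c =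
      ∑ r, ∑ f, ((D' r f : ℝ) : ℂ) • ∑ p, (((1 - k) p r : ℝ) : ℂ) •
        ∑ d, ∑ b, (((1 - k) b d : ℝ) : ℂ) • L b p d f := by
  rw [← realMat_one, ← realMat_add, ← realMat_sub]
  generalize 1 + k = u at *
  generalize 1 - k = v at *
  have h1 : ∀ b p c, (realMat v * L b p * realMat u) b c =
      ∑ f, ∑ d, ((u f c : ℝ) : ℂ) • ((v b d : ℝ) : ℂ) • L b p d f := by
    intro b p c
    simp [Matrix.mul_apply, realMat, Finset.smul_sum, smul_smul, mul_comm]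
  -- The factor `1 + k` acting on the last leg is absorbed into the inverse metric, whose adapted
  -- form is `D'`.
  have h2 : ∀ p f, ∑ c, P p c * u f c = ∑ r, v p r * D' r f := by
    intro p f
    have := congrFun (congrFun hP p) f
    simpa [Matrix.mul_apply] using this
  calc _ = ∑ p, ∑ f, ∑ b, ∑ d, ((∑ c, P p c * u f c : ℝ) : ℂ) • ((v b d : ℝ) : ℂ) • L b p d f := by
        refine Finset.sum_congr rfl fun p _ => ?_
        simp_rw [h1, Finset.smul_sum, Complex.ofReal_sum, Finset.sum_smul, Complex.ofReal_mul,
          mul_smul]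
        rw [Finset.sum_comm]
        refine (Finset.sum_congr rfl fun b _ => Finset.sum_comm).trans ?_
        rw [Finset.sum_comm]
        exact Finset.sum_congr rfl fun f _ => Finset.sum_congr rfl fun b _ => Finset.sum_comm
    _ = _ := by
        simp_rw [h2, Finset.smul_sum, Complex.ofReal_sum, Finset.sum_smul, Complex.ofReal_mul,
          mul_comm (((v _ _ : ℝ) : ℂ)) (((D' _ _ : ℝ) : ℂ)), mul_smul]
        rw [Finset.sum_comm]
        conv_rhs => rw [Finset.sum_comm]
        refine Finset.sum_congr rfl fun f _ => ?_
        conv_rhs => rw [Finset.sum_comm]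
        refine Finset.sum_congr rfl fun p _ => ?_
        rw [Finset.sum_comm]
        conv_rhs => rw [Finset.sum_comm]
        exact Finset.sum_congr rfl fun d _ => Finset.sum_comm

/-! ## The adapted frame `dx^μ, ω = s^1 + k_μ dx^μ, s^2` -/

/-- The nilpotent part of the change of frame from `dx^μ, s^1, s^2` to `dx^μ, ω, s^2`. -/
def shiftMatrix (k : Fin n → ℝ) : Matrix (Ix n) (Ix n) ℝ :=
  Matrix.fromBlocks 0 0 (Matrix.of fun i μ => ![k μ, 0] i) 0

/-- The inverse metric in the adapted frame. -/
def adaptedInverse (Gi : Matrix (Fin n) (Fin n) ℝ) (h : ℝ) : Matrix (Ix n) (Ix n) ℝ :=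
  Matrix.fromBlocks Gi 0 0 !![1 / h, 0; 0, -(1 / h)]

theorem one_sub_shiftMatrix (k : Fin n → ℝ) :
    1 - shiftMatrix k =
      Matrix.fromBlocks 1 0 (Matrix.of fun i μ => ![-k μ, 0] i) 1 := by
  rw [shiftMatrix, ← Matrix.fromBlocks_one, sub_eq_add_neg, Matrix.fromBlocks_neg,
    Matrix.fromBlocks_add]
  congr 1
  · simp
  · simp
  · ext i μ
    fin_cases i <;> simp
  · simp

/-- The subtractions `- k • L (inr 0) …` re-express the two lifted legs in the adapted frame: since
`s^1 = ω - k_μ dx^μ`, a `dx^μ` coefficient loses `k_μ` times the `s^1` coefficient. -/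
theorem adapted_contraction (k : Fin n → ℝ) (Gi : Matrix (Fin n) (Fin n) ℝ) (h : ℝ)
    (L : Ix n → Ix n → FrameMat n) :
    ∑ r, ∑ f, ((adaptedInverse Gi h r f : ℝ) : ℂ) • ∑ p, (((1 - shiftMatrix k) p r : ℝ) : ℂ) •
        ∑ d, ∑ b, (((1 - shiftMatrix k) b d : ℝ) : ℂ) • L b p d f =
      ∑ l, ∑ ν, Gi l ν • (
        ∑ μ, (L (Sum.inl μ) (Sum.inl l) (Sum.inl μ) (Sum.inl ν)
          - k μ • L (Sum.inr 0) (Sum.inl l) (Sum.inl μ) (Sum.inl ν))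
        + L (Sum.inr 0) (Sum.inl l) (Sum.inr 0) (Sum.inl ν)
        + L (Sum.inr 1) (Sum.inl l) (Sum.inr 1) (Sum.inl ν)
        - k l • (∑ μ, (L (Sum.inl μ) (Sum.inr 0) (Sum.inl μ) (Sum.inl ν)
          - k μ • L (Sum.inr 0) (Sum.inr 0) (Sum.inl μ) (Sum.inl ν))
        + L (Sum.inr 0) (Sum.inr 0) (Sum.inr 0) (Sum.inl ν)
        + L (Sum.inr 1) (Sum.inr 0) (Sum.inr 1) (Sum.inl ν)))
      + (1 / h) • (∑ μ, (L (Sum.inl μ) (Sum.inr 0) (Sum.inl μ) (Sum.inr 0)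
          - k μ • L (Sum.inr 0) (Sum.inr 0) (Sum.inl μ) (Sum.inr 0))
        + L (Sum.inr 0) (Sum.inr 0) (Sum.inr 0) (Sum.inr 0)
        + L (Sum.inr 1) (Sum.inr 0) (Sum.inr 1) (Sum.inr 0))
      - (1 / h) • (∑ μ, (L (Sum.inl μ) (Sum.inr 1) (Sum.inl μ) (Sum.inr 1)
          - k μ • L (Sum.inr 0) (Sum.inr 1) (Sum.inl μ) (Sum.inr 1))
        + L (Sum.inr 0) (Sum.inr 1) (Sum.inr 0) (Sum.inr 1)
        + L (Sum.inr 1) (Sum.inr 1) (Sum.inr 1) (Sum.inr 1)) := by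
  rw [one_sub_shiftMatrix]
  have hT : ∀ p f, ∑ d, ∑ b, (((Matrix.fromBlocks 1 0 (Matrix.of fun i μ => ![-k μ, 0] i) 1 :
        Matrix (Ix n) (Ix n) ℝ) b d : ℝ) : ℂ) • L b p d f =
      ∑ μ, (L (Sum.inl μ) p (Sum.inl μ) f - k μ • L (Sum.inr 0) p (Sum.inl μ) f)
        + L (Sum.inr 0) p (Sum.inr 0) f + L (Sum.inr 1) p (Sum.inr 1) f := by
    intro p f
    simp only [Fintype.sum_sum_type, Fin.sum_univ_two, Matrix.fromBlocks_apply₁₁,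
      Matrix.fromBlocks_apply₁₂, Matrix.fromBlocks_apply₂₁, Matrix.fromBlocks_apply₂₂,
      Matrix.one_apply, Matrix.of_apply, Complex.coe_smul]
    simp [ite_smul, sub_eq_add_neg, add_assoc]
  simp only [hT]
  generalize hR : (fun p f => ∑ μ, (L (Sum.inl μ) p (Sum.inl μ) f -
    k μ • L (Sum.inr 0) p (Sum.inl μ) f) + L (Sum.inr 0) p (Sum.inr 0) f +
      L (Sum.inr 1) p (Sum.inr 1) f) = R
  have hR' := fun p f => congrFun (congrFun hR p) f
  beta_reduce at hR'
  simp only [hR']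
  simp only [adaptedInverse, Fintype.sum_sum_type, Fin.sum_univ_two, Matrix.fromBlocks_apply₁₁,
      Matrix.fromBlocks_apply₁₂, Matrix.fromBlocks_apply₂₁, Matrix.fromBlocks_apply₂₂,
      Matrix.one_apply, Matrix.of_apply, Complex.coe_smul]
  simp [ite_smul, sub_eq_add_neg, add_assoc]

/-- The connection in the adapted frame: `∇dx^μ = -Γ^μ_{αβ} dx^α ⊗ dx^β + B^μ_α (dx^α ⊗ ω +
ω ⊗ dx^α)`, `∇ω = (1/2h) F_{αβ} dx^α ⊗ dx^β + ı σ^1 ω ⊗ ω`. The first index is the component of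
the left leg in the basis `dx^μ, s^1, s^2`. -/
def adaptedConn (Γ : Fin n → Fin n → Fin n → E n → ℝ) (B F : Fin n → Fin n → E n → ℝ)
    (k : Fin n → E n → ℝ) (h : ℝ) (ρ : E n → ℂ) : Ix n → E n → FrameMat n
  | Sum.inl l => fun z => Matrix.fromBlocks
      (Matrix.of fun μ ν => algebraMap ℝ M2 (-Γ μ l ν z + k l z * B μ ν z))
      (Matrix.of fun μ j => ![algebraMap ℝ M2 (B μ l z), 0] j)
      (Matrix.of fun i ν => ![algebraMap ℝ M2 (F l ν z / (2 * h)), 0] i)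
      !![(Complex.I * k l z) • pauli 0, 0; 0, 0]
  | Sum.inr i => fun z => Matrix.fromBlocks
      (Matrix.of fun μ ν => ![algebraMap ℝ M2 (B μ ν z), 0] i) 0 0
      !![![Complex.I • pauli 0, 0] i, 0; 0, ![(-2 * ρ z) • pauli 1, Complex.I • pauli 1] i]

/-! ### Entries of the lifted curvature of the adapted connection. -/

set_option linter.unusedSimpArgs false

section Entries

variable (Γ : Fin n → Fin n → Fin n → E n → ℝ) (B F : Fin n → Fin n → E n → ℝ)
    (k : Fin n → E n → ℝ) (h : ℝ) (ρ : E n → ℂ) (y : E n)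

theorem deriv0_algebraMap_inl {f : E n → ℝ} {y : E n} (hf : DifferentiableAt ℝ f y) (μ : Fin n) :
    deriv0 (fun z => algebraMap ℝ M2 (f z)) (Sum.inl μ) y = algebraMap ℝ M2 (pd μ f y) := by
  ext p q
  simp only [deriv0, Matrix.algebraMap_matrix_apply, Matrix.of_apply]
  split_ifs
  · have h1 := (Complex.ofRealCLM.hasFDerivAt (x := f y)).comp y hf.hasFDerivAt
    have h2 : (fun z => algebraMap ℝ ℂ (f z)) = Complex.ofRealCLM ∘ f := rfl
    rw [h2, h1.fderiv]
    simp [pd]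
  · simp

theorem deriv0_zero (a : Ix n) (y : E n) : deriv0 (fun _ => 0) a y = 0 := by
  rcases a with μ | i
  · ext p q; simp [deriv0]
  · simp [deriv0]

theorem deriv0_algebraMap_inr (f : E n → ℝ) (i : Fin 2) (y : E n) :
    deriv0 (fun z => algebraMap ℝ M2 (f z)) (Sum.inr i) y = 0 := by
  simp [deriv0, Algebra.commutes]

theorem half_smul_algebraMap (r : ℝ) :
    (1 / 2 : ℂ) • algebraMap ℝ M2 r = algebraMap ℝ M2 (1 / 2 * r) := by
  rw [map_mul, ← Algebra.smul_def, ← Complex.coe_smul]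
  simp

theorem algebraMap_mul_eq_smul (r : ℝ) (x : M2) : algebraMap ℝ M2 r * x = (r : ℂ) • x := by
  rw [← Algebra.smul_def, Complex.coe_smul]

theorem mul_algebraMap_eq_smul (r : ℝ) (x : M2) : x * algebraMap ℝ M2 r = (r : ℂ) • x := by
  rw [← Algebra.commutes, algebraMap_mul_eq_smul]

theorem mul_pauliScalar_apply (X : FrameMat n) (i : Fin 2) (b c : Ix n) :
    (X * pauliScalar n i) b c = X b c * pauli i := by
  simp [pauliScalar]

theorem halfCurv_apply (N : Ix n → E n → FrameMat n) (a a' b c : Ix n) (y : E n) :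
    halfCurv N a a' y b c = deriv0 (fun z => N a' z b c) a y -
      (∑ κ, N a y b (Sum.inl κ) * N a' y (Sum.inl κ) c +
        (N a y b (Sum.inr 0) * N a' y (Sum.inr 0) c +
          N a y b (Sum.inr 1) * N a' y (Sum.inr 1) c)) := by
  simp [halfCurv, dMat, Matrix.mul_apply]

theorem deriv0_pauli (c : ℂ) (i : Fin 2) (y : E n) :
    deriv0 (fun _ => c • pauli i) (Sum.inr i) y = 0 := by
  simp [deriv0]

theorem pauli_mul_self (i : Fin 2) : pauli i * pauli i = 1 := by
  fin_cases i <;> ext p q <;> fin_cases p <;> fin_cases q <;> simp [pauli]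

/-- This and the following entry lemmas supply the entries needed in `adapted_contraction`. The
first two indices refer to `dx^μ, s^i` and the last two to the adapted frame; this mixture is why
`k` appears explicitly here. -/
theorem liftMat_adaptedConn_xx {Γ B k} {y : E n}
    (hΓ : ∀ σ μ ν, DifferentiableAt ℝ (Γ σ μ ν) y)
    (hB : ∀ μ ν, DifferentiableAt ℝ (B μ ν) y) (hk : ∀ μ, DifferentiableAt ℝ (k μ) y)
    (μ l ν : Fin n) :
    liftMat (adaptedConn Γ B F k h ρ) y (Sum.inl μ) (Sum.inl l) (Sum.inl μ) (Sum.inl ν) =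
      algebraMap ℝ M2 (1 / 2 * (
        (-pd μ (Γ μ l ν) y + (pd μ (k l) y * B μ ν y + k l y * pd μ (B μ ν) y))
        - (-pd l (Γ μ μ ν) y + (pd l (k μ) y * B μ ν y + k μ y * pd l (B μ ν) y))
        - (∑ κ, (-Γ μ μ κ y + k μ y * B μ κ y) * (-Γ κ l ν y + k l y * B κ ν y)
          + B μ μ y * (F l ν y / (2 * h)))
        + (∑ κ, (-Γ μ l κ y + k l y * B μ κ y) * (-Γ κ μ ν y + k μ y * B κ ν y)
          + B μ l y * (F μ ν y / (2 * h))))) := by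
  have hd : ∀ μ l ν κ, deriv0 (fun z => algebraMap ℝ M2 (-Γ μ l ν z + k l z * B μ ν z))
      (Sum.inl κ) y = algebraMap ℝ M2 (-pd κ (Γ μ l ν) y +
        (pd κ (k l) y * B μ ν y + k l y * pd κ (B μ ν) y)) := by
    intro μ l ν κ
    rw [deriv0_algebraMap_inl (f := fun z => -Γ μ l ν z + k l z * B μ ν z)
      (((hΓ μ l ν).neg).add ((hk l).mul (hB μ ν)))]
    congr 1
    simp only [pd]
    rw [fderiv_fun_add (hΓ μ l ν).fun_neg ((hk l).fun_mul (hB μ ν)), fderiv_fun_neg,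
      fderiv_fun_mul (hk l) (hB μ ν)]
    simp
    ring
  simp only [liftMat, halfCurv, adaptedConn, Matrix.smul_apply, Matrix.sub_apply, dMat,
    Matrix.mul_apply, Fintype.sum_sum_type, Fin.sum_univ_two, Matrix.of_apply,
    Matrix.fromBlocks_apply₁₁, Matrix.fromBlocks_apply₁₂, Matrix.fromBlocks_apply₂₁, hd,
    Matrix.cons_val_zero, Matrix.cons_val_one, mul_zero, add_zero]
  simp only [← map_mul, ← map_sum, ← map_sub, ← map_add]
  rw [half_smul_algebraMap]
  congr 2
  ring

theorem liftMat_adaptedConn_xs {B} {y : E n} (hB : ∀ μ ν, DifferentiableAt ℝ (B μ ν) y)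
    (μ l ν : Fin n) :
    liftMat (adaptedConn Γ B F k h ρ) y (Sum.inl l) (Sum.inr 0) (Sum.inl μ) (Sum.inl ν) =
      algebraMap ℝ M2 (1 / 2 * (pd l (B μ ν) y
        + ∑ κ, (Γ μ l κ y * B κ ν y - B μ κ y * Γ κ l ν y))) := by
  simp only [liftMat, halfCurv, adaptedConn, Matrix.smul_apply, Matrix.sub_apply, dMat,
    Matrix.mul_apply, Fintype.sum_sum_type, Fin.sum_univ_two, Matrix.of_apply,
    Matrix.fromBlocks_apply₁₁, Matrix.fromBlocks_apply₁₂, Matrix.fromBlocks_apply₂₁,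
    Matrix.cons_val_zero, mul_zero, add_zero, deriv0_algebraMap_inr,
    Matrix.zero_apply, zero_mul, deriv0_algebraMap_inl (hB _ _)]
  simp only [← map_mul, ← map_sum, ← map_sub, zero_sub, ← map_neg]
  rw [half_smul_algebraMap]
  congr 2
  rw [sub_neg_eq_add, sub_add, ← Finset.sum_sub_distrib, sub_eq_add_neg, ← Finset.sum_neg_distrib]
  congr 1
  refine Finset.sum_congr rfl fun κ _ => ?_
  ring

/-- The `σ^1` term comes from `ds^1 = -σ^1 Vol`, with `-1/(2ı) = ı/2`. -/
theorem liftMat_adaptedConn_ss (μ ν : Fin n) :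
    liftMat (adaptedConn Γ B F k h ρ) y (Sum.inr 0) (Sum.inr 0) (Sum.inl μ) (Sum.inl ν) =
      algebraMap ℝ M2 (-(1 / 2 * ∑ κ, B μ κ y * B κ ν y)) +
        (Complex.I / 2 * B μ ν y) • pauli 0 := by
  simp only [liftMat, adaptedConn, Matrix.smul_apply, Matrix.sub_apply, halfCurv_apply,
    mul_pauliScalar_apply, Fin.sum_univ_two, Matrix.of_apply, Matrix.neg_apply, Matrix.add_apply,
    Matrix.fromBlocks_apply₁₁, Matrix.fromBlocks_apply₁₂, Matrix.fromBlocks_apply₂₁,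
    Matrix.fromBlocks_apply₂₂, if_true, Matrix.cons_val_zero, Matrix.cons_val_one, mul_zero,
    add_zero, zero_add, deriv0_algebraMap_inr, Matrix.zero_apply, zero_mul, deriv0_zero,
    Pi.zero_apply, Finset.sum_const_zero, zero_sub, sub_zero, Matrix.cons_val', Matrix.cons_val_fin_one, ← map_mul, ← map_sum, ← map_neg,
    half_smul_algebraMap, algebraMap_mul_eq_smul, smul_smul, mul_neg, neg_zero]
  rw [sub_eq_add_neg, ← neg_smul]
  congr 2
  field_simp
  simp

/-- The `σ^1` term is the product of the coefficient `ı σ^1` of `ω ⊗ ω` in `∇ω` with its `F` part.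
-/
theorem liftMat_adaptedConn_sx (l ν : Fin n) :
    liftMat (adaptedConn Γ B F k h ρ) y (Sum.inr 0) (Sum.inl l) (Sum.inr 0) (Sum.inl ν) =
      algebraMap ℝ M2 (1 / 2 * ∑ κ, F l κ y / (2 * h) * B κ ν y) -
        (Complex.I / 2 * (F l ν y / (2 * h) : ℝ)) • pauli 0 := by
  simp only [liftMat, adaptedConn, Matrix.smul_apply, Matrix.sub_apply, halfCurv_apply,
    mul_pauliScalar_apply, Fin.sum_univ_two, Matrix.of_apply, Matrix.neg_apply, Matrix.add_apply,
    Matrix.fromBlocks_apply₁₁, Matrix.fromBlocks_apply₁₂, Matrix.fromBlocks_apply₂₁,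
    Matrix.fromBlocks_apply₂₂, if_true, Matrix.cons_val_zero, Matrix.cons_val_one, mul_zero,
    add_zero, zero_add, deriv0_algebraMap_inr, Matrix.zero_apply, zero_mul, deriv0_zero,
    Pi.zero_apply, Finset.sum_const_zero, zero_sub, sub_zero, Matrix.cons_val', Matrix.cons_val_fin_one, ← map_mul, ← map_sum, mul_algebraMap_eq_smul,
    smul_smul, sub_neg_eq_add, smul_add, smul_neg, half_smul_algebraMap, neg_add_rev, neg_neg]
  rw [sub_eq_add_neg, add_comm, ← neg_smul, ← neg_smul]
  congr 2
  ring

theorem liftMat_adaptedConn_trace (μ : Fin n) :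
    liftMat (adaptedConn Γ B F k h ρ) y (Sum.inl μ) (Sum.inr 0) (Sum.inl μ) (Sum.inr 0) =
      algebraMap ℝ M2 (1 / 2 * ∑ κ, B μ κ y * B κ μ y) -
        (Complex.I / 2 * B μ μ y) • pauli 0 := by
  simp only [liftMat, adaptedConn, Matrix.smul_apply, Matrix.sub_apply, halfCurv_apply,
    mul_pauliScalar_apply, Fin.sum_univ_two, Matrix.of_apply, Matrix.neg_apply, Matrix.add_apply,
    Matrix.fromBlocks_apply₁₁, Matrix.fromBlocks_apply₁₂, Matrix.fromBlocks_apply₂₁,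
    Matrix.fromBlocks_apply₂₂, if_true, Matrix.cons_val_zero, Matrix.cons_val_one, mul_zero,
    add_zero, zero_add, deriv0_algebraMap_inr, Matrix.zero_apply, zero_mul, deriv0_zero,
    Pi.zero_apply, Finset.sum_const_zero, zero_sub, sub_zero, Matrix.cons_val', Matrix.cons_val_fin_one, ← map_mul, ← map_sum, algebraMap_mul_eq_smul,
    smul_smul, sub_neg_eq_add, smul_add, smul_neg, half_smul_algebraMap, neg_add_rev, neg_neg]
  rw [sub_eq_add_neg, add_comm, ← neg_smul, ← neg_smul]
  congr 2
  ring

/-- The source of `2ρ²/h`. With coefficients `-2ρσ^2` along `s^1` and `ıσ^2` along `s^2`, the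
curvature halves contribute `ρσ^3 - 2ρ² + ½`, and the `ds^i` term contributes `-ρσ^3 - ½`. -/
theorem liftMat_adaptedConn_s₂s₂ :
    liftMat (adaptedConn Γ B F k h ρ) y (Sum.inr 1) (Sum.inr 1) (Sum.inr 1) (Sum.inr 1) =
      (-2 * ρ y ^ 2) • (1 : M2) := by
  simp only [liftMat, adaptedConn, Matrix.smul_apply, Matrix.sub_apply, halfCurv_apply,
    mul_pauliScalar_apply, Fin.sum_univ_two, Matrix.of_apply, Matrix.neg_apply, Matrix.add_apply,
    Matrix.fromBlocks_apply₁₁, Matrix.fromBlocks_apply₁₂, Matrix.fromBlocks_apply₂₁,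
    Matrix.fromBlocks_apply₂₂, if_true, Matrix.cons_val_zero, Matrix.cons_val_one, mul_zero,
    add_zero, zero_add, deriv0_algebraMap_inr, Matrix.zero_apply, zero_mul, deriv0_zero,
    Pi.zero_apply, Finset.sum_const_zero, zero_sub, sub_zero, Matrix.cons_val', Matrix.cons_val_fin_one, deriv0]
  ext p q
  fin_cases p <;> fin_cases q <;> simp [pauli] <;> ring_nf <;> simp

/-- Most of these vanish by the block structure. The `ω, ω` entry vanishes because `-(ıσ^1)² = 1`,
halved, cancels the contribution `-½` of `ds^1`; the last two vanish because the lift has no `s^1 ⊗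
s^2` part. -/
theorem liftMat_adaptedConn_zero :
    (∀ l ν, liftMat (adaptedConn Γ B F k h ρ) y (Sum.inr 1) (Sum.inl l) (Sum.inr 1) (Sum.inl ν) = 0) ∧
    (∀ ν, liftMat (adaptedConn Γ B F k h ρ) y (Sum.inr 0) (Sum.inr 0) (Sum.inr 0) (Sum.inl ν) = 0) ∧
    (∀ μ, liftMat (adaptedConn Γ B F k h ρ) y (Sum.inr 0) (Sum.inr 0) (Sum.inl μ) (Sum.inr 0) = 0) ∧
    liftMat (adaptedConn Γ B F k h ρ) y (Sum.inr 0) (Sum.inr 0) (Sum.inr 0) (Sum.inr 0) = 0 ∧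
    (∀ μ, liftMat (adaptedConn Γ B F k h ρ) y (Sum.inl μ) (Sum.inr 1) (Sum.inl μ) (Sum.inr 1) = 0) ∧
    liftMat (adaptedConn Γ B F k h ρ) y (Sum.inr 0) (Sum.inr 1) = 0 ∧
    liftMat (adaptedConn Γ B F k h ρ) y (Sum.inr 1) (Sum.inr 0) = 0 := by
  refine ⟨fun l ν => ?_, fun ν => ?_, fun μ => ?_, ?_, fun μ => ?_, rfl, rfl⟩ <;>
  simp only [liftMat, adaptedConn, Matrix.smul_apply, Matrix.sub_apply, halfCurv_apply,
    mul_pauliScalar_apply, Fin.sum_univ_two, Matrix.of_apply, Matrix.neg_apply, Matrix.add_apply,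
    Matrix.fromBlocks_apply₁₁, Matrix.fromBlocks_apply₁₂, Matrix.fromBlocks_apply₂₁,
    Matrix.fromBlocks_apply₂₂, if_true, Matrix.cons_val_zero, Matrix.cons_val_one, mul_zero,
    add_zero, zero_add, deriv0_algebraMap_inr, Matrix.zero_apply, zero_mul, deriv0_zero,
    Pi.zero_apply, Finset.sum_const_zero, zero_sub, sub_zero, Matrix.cons_val', Matrix.cons_val_fin_one, deriv0_pauli, smul_zero, neg_zero]
  simp only [smul_mul_assoc, mul_smul_comm, pauli_mul_self]
  ext p q
  simp only [Matrix.sub_apply, Matrix.smul_apply, Matrix.neg_apply, smul_eq_mul, Matrix.zero_apply]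
  field_simp
  simp

end Entries

/-! ## Contractions of an antisymmetric tensor -/

section Contractions

variable {G F B : Matrix (Fin n) (Fin n) ℝ}

theorem sum_mul_eq_trace (X Y : Matrix (Fin n) (Fin n) ℝ) :
    ∑ i, ∑ j, X i j * Y i j = (X * Yᵀ).trace := by
  simp [Matrix.trace, Matrix.mul_apply]

theorem normSq₂_eq_trace (hG : Gᵀ = G) (hF : Fᵀ = -F) :
    ∑ μ, ∑ ν, ∑ α, ∑ β, G μ α * G ν β * F μ ν * F α β = -(G * F * G * F).trace := by
  have h1 : ∀ μ ν, ∑ α, ∑ β, G μ α * G ν β * F μ ν * F α β = F μ ν * (G * F * Gᵀ) μ ν := by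
    intro μ ν
    simp only [Matrix.mul_apply, Matrix.transpose_apply, Finset.sum_mul, Finset.mul_sum]
    rw [Finset.sum_comm]
    exact Finset.sum_congr rfl fun _ _ => Finset.sum_congr rfl fun _ _ => by ring
  simp only [h1, sum_mul_eq_trace]
  simp only [Matrix.transpose_mul, hG, hF]
  rw [Matrix.trace_mul_comm]
  simp [Matrix.mul_assoc]

/-- Transposition and cyclicity send the trace to its own negative. -/
theorem trace_mul_antisymm (hG : Gᵀ = G) (hF : Fᵀ = -F) : (G * F).trace = 0 := by
  have h1 : (G * F).trace = -(G * F).trace := by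
    conv_lhs => rw [← Matrix.trace_transpose, Matrix.transpose_mul, hF, hG, Matrix.neg_mul,
      Matrix.trace_neg, Matrix.trace_mul_comm]
  linarith

/-- Every term is a multiple of `tr(GFGF) = -‖F‖²`, except `tr B = 0`. In units of `‖F‖²/h` the
bracket gives `¼ + ⅛ - ⅛` and the final `B B` term gives `-⅛`. -/
theorem quadratic_contraction (hG : Gᵀ = G) (hF : Fᵀ = -F) (hB : B = (1 / 2 : ℝ) • (G * F))
    (h : ℝ) :
    ∑ l, ∑ ν, G l ν * (∑ μ, (1 / (2 * h) * (F μ l * B μ ν) + 1 / (4 * h) * (B μ l * F μ ν)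
        - 1 / (4 * h) * (B μ μ * F l ν)) + 1 / (4 * h) * ∑ κ, F l κ * B κ ν)
      + 1 / h * ∑ μ, 1 / 2 * ∑ κ, B μ κ * B κ μ =
    1 / (8 * h) * ∑ μ, ∑ ν, ∑ α, ∑ β, G μ α * G ν β * F μ ν * F α β := by
  have hBt : Bᵀ = -((1 / 2 : ℝ) • (F * G)) := by
    rw [hB, Matrix.transpose_smul, Matrix.transpose_mul, hG, hF]; simp
  have htr : ∑ μ, B μ μ = 0 := by
    have : B.trace = 0 := by rw [hB, Matrix.trace_smul, trace_mul_antisymm hG hF, smul_zero]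
    exact this
  have h1 : ∀ l ν, ∑ μ, (1 / (2 * h) * (F μ l * B μ ν) + 1 / (4 * h) * (B μ l * F μ ν)
        - 1 / (4 * h) * (B μ μ * F l ν)) + 1 / (4 * h) * ∑ κ, F l κ * B κ ν =
      ((1 / (2 * h)) • (Fᵀ * B) + (1 / (4 * h)) • (Bᵀ * F) + (1 / (4 * h)) • (F * B)) l ν := by
    intro l ν
    simp only [Finset.sum_sub_distrib, Finset.sum_add_distrib, ← Finset.mul_sum, ← Finset.sum_mul,
      htr, Matrix.add_apply, Matrix.smul_apply, Matrix.mul_apply, Matrix.transpose_apply,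
      smul_eq_mul]
    ring
  have h2 : ∑ μ, 1 / 2 * ∑ κ, B μ κ * B κ μ = 1 / 2 * (B * B).trace := by
    simp [Matrix.trace, Matrix.mul_apply, Finset.mul_sum]
  simp only [h1, h2, sum_mul_eq_trace, normSq₂_eq_trace hG hF]
  simp only [Matrix.transpose_add, Matrix.transpose_smul, Matrix.transpose_mul,
    Matrix.transpose_transpose]
  rw [hBt]
  simp only [hB, hF, Matrix.smul_mul, Matrix.mul_smul, Matrix.trace_add, Matrix.trace_smul,
    Matrix.mul_add, Matrix.neg_mul, Matrix.mul_neg, Matrix.trace_neg, smul_eq_mul,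
    Matrix.mul_assoc]
  ring

/-- Both sides are multiples of `A · G F G F G A`: the `¼` is the square of the factor in `B = ½ G
F`, and the sign comes from transposing one `F`. -/
theorem quartic_contraction (hG : Gᵀ = G) (hF : Fᵀ = -F) (hB : B = (1 / 2 : ℝ) • (G * F))
    (A : Fin n → ℝ) :
    ∑ l, ∑ ν, G l ν * (A l * ∑ μ, ∑ κ, A μ * B μ κ * B κ ν) =
      -(1 / 4) * ∑ μ, ∑ ν, G μ ν * (∑ α, ∑ β, G α β * A α * F β μ) *
        (∑ α, ∑ β, G α β * A α * F β ν) := by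
  have hw : ∀ μ, ∑ α, ∑ β, G α β * A α * F β μ = (A ᵥ* (G * F)) μ := by
    intro μ
    simp only [Matrix.vecMul, dotProduct, Matrix.mul_apply, Finset.mul_sum]
    exact Finset.sum_congr rfl fun _ _ => Finset.sum_congr rfl fun _ _ => by ring
  have hv : ∀ ν, ∑ μ, ∑ κ, A μ * B μ κ * B κ ν = (A ᵥ* (B * B)) ν := by
    intro ν
    simp only [Matrix.vecMul, dotProduct, Matrix.mul_apply, Finset.mul_sum]
    exact Finset.sum_congr rfl fun _ _ => Finset.sum_congr rfl fun _ _ => by ring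
  have h1 : ∀ (u v : Fin n → ℝ), ∑ l, ∑ ν, G l ν * (u l * v ν) = u ⬝ᵥ (G *ᵥ v) := by
    intro u v
    simp only [Matrix.mulVec, dotProduct, Finset.mul_sum]
    exact Finset.sum_congr rfl fun _ _ => Finset.sum_congr rfl fun _ _ => by ring
  simp only [hw, hv]
  simp only [mul_assoc, h1]
  have h2 : A ᵥ* (G * F) = -((F * G) *ᵥ A) := by
    rw [← Matrix.mulVec_transpose, Matrix.transpose_mul, hG, hF, Matrix.neg_mul, Matrix.neg_mulVec]
  have h3 : A ᵥ* (B * B) = (1 / 4 : ℝ) • ((F * G * (F * G)) *ᵥ A) := by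
    rw [← Matrix.mulVec_transpose, Matrix.transpose_mul, hB, Matrix.transpose_smul,
      Matrix.transpose_mul, hG, hF]
    simp only [Matrix.neg_mul, smul_neg, Matrix.mul_neg, neg_neg, Matrix.smul_mul,
      Matrix.mul_smul, smul_smul, Matrix.smul_mulVec]
    norm_num
  have h4 : A ᵥ* (G * F) ⬝ᵥ (G *ᵥ (A ᵥ* (G * F))) = -(A ⬝ᵥ (G *ᵥ ((F * G * (F * G)) *ᵥ A))) := by
    rw [← Matrix.dotProduct_mulVec, h2]
    simp only [Matrix.mulVec_neg, dotProduct_neg, Matrix.mulVec_mulVec, Matrix.mul_assoc]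
  rw [h4, h3, Matrix.mulVec_smul, dotProduct_smul, smul_eq_mul]
  ring

end Contractions

/-! ## The Ricci scalar in the adapted frame -/

/-- Separates the scalar part from the `σ^1` part of the `dx^l ⊗ dx^ν` contraction, so that each can
be treated as a real tensor. The zeros hold the places of the vanishing entries. -/
theorem frame_sum_eq (e₁ e₂ e₃ e₄ b k : Fin n → ℝ) (s f c : ℝ) :
    ∑ μ, (algebraMap ℝ M2 (e₁ μ) - k μ • -algebraMap ℝ M2 (e₂ μ))
      + (algebraMap ℝ M2 s - (Complex.I / 2 * (f : ℝ)) • pauli 0) + 0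
      - c • (∑ μ, (algebraMap ℝ M2 (e₃ μ) - k μ •
        (algebraMap ℝ M2 (e₄ μ) + (Complex.I / 2 * (b μ : ℝ)) • pauli 0)) + 0 + 0) =
    algebraMap ℝ M2 (∑ μ, (e₁ μ + k μ * e₂ μ) + s - c * ∑ μ, (e₃ μ - k μ * e₄ μ)) +
      (Complex.I / 2 * ((-f + c * ∑ μ, k μ * b μ : ℝ) : ℂ)) • pauli 0 := by
  have h1 : ∑ μ, (algebraMap ℝ M2 (e₁ μ) - k μ • -algebraMap ℝ M2 (e₂ μ)) =
      algebraMap ℝ M2 (∑ μ, (e₁ μ + k μ * e₂ μ)) := by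
    simp only [map_sum, map_add, map_mul, Algebra.smul_def, mul_neg, sub_neg_eq_add]
  have h2 : ∑ μ, (algebraMap ℝ M2 (e₃ μ) - k μ •
        (algebraMap ℝ M2 (e₄ μ) + (Complex.I / 2 * (b μ : ℝ)) • pauli 0)) =
      algebraMap ℝ M2 (∑ μ, (e₃ μ - k μ * e₄ μ)) -
        (Complex.I / 2 * ((∑ μ, k μ * b μ : ℝ) : ℂ)) • pauli 0 := by
    rw [Complex.ofReal_sum, Finset.mul_sum, Finset.sum_smul, map_sum, ← Finset.sum_sub_distrib]
    refine Finset.sum_congr rfl fun μ _ => ?_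
    rw [smul_add, map_sub, map_mul, ← Algebra.smul_def, sub_sub,
      ← Complex.coe_smul (k μ) ((Complex.I / 2 * (b μ : ℂ)) • _), smul_smul]
    congr 3
    push_cast
    ring
  rw [h1, h2, map_sub, map_add, map_mul, ← Algebra.smul_def]
  generalize ∑ μ, k μ * b μ = t
  rw [smul_add, smul_add, smul_sub, ← Complex.coe_smul c ((Complex.I / 2 * (t : ℂ)) • _),
    smul_zero]
  push_cast
  module

/-- The Ricci tensor of the connection with symbols `Γ`. -/
def ricciOf (Γ : Fin n → Fin n → Fin n → E n → ℝ) (α β : Fin n) (y : E n) : ℝ :=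
  ∑ μ, (pd μ (Γ μ α β) y - pd α (Γ μ μ β) y
    + ∑ κ, (Γ μ μ κ y * Γ κ α β y - Γ μ α κ y * Γ κ μ β y))

theorem sum_add_sub_eq_of_forall (T₁ T₂ R Q V : Fin n → ℝ) (c z : ℝ)
    (H : ∀ μ, T₁ μ - c * T₂ μ = -(1 / 2) * R μ + Q μ - 1 / 2 * (c * V μ)) :
    ∑ μ, T₁ μ + z - c * ∑ μ, T₂ μ =
      -(1 / 2) * ∑ μ, R μ + (∑ μ, Q μ + z) - 1 / 2 * (c * ∑ μ, V μ) := by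
  have h1 := Finset.sum_congr (rfl : Finset.univ = Finset.univ) fun μ _ => H μ
  simp only [Finset.sum_sub_distrib, Finset.sum_add_distrib, ← Finset.mul_sum] at h1
  linear_combination h1

/-- The corrections by `k` cancel all terms in `∂B` and in `Γ B`. The only derivatives left besides
those in the Ricci tensor are `½ B^μ_ν (∂_μ k_l - ∂_l k_μ)`, which `hdk` converts into `F`; the `k k
B B` products cancel inside the `dx`-block and survive only from the `s^1, s^1` entry. -/
theorem real_frame_sum (Γ : Fin n → Fin n → Fin n → E n → ℝ) (B F : Fin n → Fin n → E n → ℝ)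
    (k : Fin n → E n → ℝ) (h : ℝ) (y : E n)
    (hdk : ∀ μ ν, pd μ (k ν) y - pd ν (k μ) y = F μ ν y / h) (l ν : Fin n) :
    ∑ μ, (1 / 2 * (
        (-pd μ (Γ μ l ν) y + (pd μ (k l) y * B μ ν y + k l y * pd μ (B μ ν) y))
        - (-pd l (Γ μ μ ν) y + (pd l (k μ) y * B μ ν y + k μ y * pd l (B μ ν) y))
        - (∑ κ, (-Γ μ μ κ y + k μ y * B μ κ y) * (-Γ κ l ν y + k l y * B κ ν y)
          + B μ μ y * (F l ν y / (2 * h)))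
        + (∑ κ, (-Γ μ l κ y + k l y * B μ κ y) * (-Γ κ μ ν y + k μ y * B κ ν y)
          + B μ l y * (F μ ν y / (2 * h))))
        + k μ y * (1 / 2 * (pd l (B μ ν) y
          + ∑ κ, (Γ μ l κ y * B κ ν y - B μ κ y * Γ κ l ν y))))
      + 1 / 2 * ∑ κ, F l κ y / (2 * h) * B κ ν y
      - k l y * ∑ μ, (1 / 2 * (pd μ (B μ ν) y
          + ∑ κ, (Γ μ μ κ y * B κ ν y - B μ κ y * Γ κ μ ν y))
        - k μ y * -(1 / 2 * ∑ κ, B μ κ y * B κ ν y)) =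
    -(1 / 2) * ricciOf Γ l ν y
      + (∑ μ, (1 / (2 * h) * (F μ l y * B μ ν y) + 1 / (4 * h) * (B μ l y * F μ ν y)
        - 1 / (4 * h) * (B μ μ y * F l ν y)) + 1 / (4 * h) * ∑ κ, F l κ y * B κ ν y)
      - 1 / 2 * (k l y * ∑ μ, ∑ κ, k μ y * B μ κ y * B κ ν y) := by
  have h1 : 1 / 2 * ∑ κ, F l κ y / (2 * h) * B κ ν y = 1 / (4 * h) * ∑ κ, F l κ y * B κ ν y := by
    simp only [Finset.mul_sum]
    exact Finset.sum_congr rfl fun κ _ => by ring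
  rw [h1, ricciOf]
  refine sum_add_sub_eq_of_forall _ _ _ _ _ _ _ fun μ => ?_
  have h2 : ∑ κ, (-Γ μ μ κ y + k μ y * B μ κ y) * (-Γ κ l ν y + k l y * B κ ν y) =
      ∑ κ, Γ μ μ κ y * Γ κ l ν y - k l y * ∑ κ, Γ μ μ κ y * B κ ν y
        - k μ y * ∑ κ, B μ κ y * Γ κ l ν y + k μ y * k l y * ∑ κ, B μ κ y * B κ ν y := by
    simp only [Finset.mul_sum, ← Finset.sum_sub_distrib, ← Finset.sum_add_distrib]
    exact Finset.sum_congr rfl fun κ _ => by ring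
  have h3 : ∑ κ, (-Γ μ l κ y + k l y * B μ κ y) * (-Γ κ μ ν y + k μ y * B κ ν y) =
      ∑ κ, Γ μ l κ y * Γ κ μ ν y - k μ y * ∑ κ, Γ μ l κ y * B κ ν y
        - k l y * ∑ κ, B μ κ y * Γ κ μ ν y + k μ y * k l y * ∑ κ, B μ κ y * B κ ν y := by
    simp only [Finset.mul_sum, ← Finset.sum_sub_distrib, ← Finset.sum_add_distrib]
    exact Finset.sum_congr rfl fun κ _ => by ring
  have h4 : ∑ κ, k μ y * B μ κ y * B κ ν y = k μ y * ∑ κ, B μ κ y * B κ ν y := by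
    simp only [Finset.mul_sum, mul_assoc]
  rw [h2, h3, h4]
  simp only [Finset.sum_sub_distrib]
  linear_combination (1 / 2 * B μ ν y) * hdk μ l

theorem smul_algebraMap_add (g r f : ℝ) :
    g • (algebraMap ℝ M2 r + (Complex.I / 2 * (f : ℂ)) • pauli 0) =
      algebraMap ℝ M2 (g * r) + (Complex.I / 2 * ((g * f : ℝ) : ℂ)) • pauli 0 := by
  rw [smul_add, map_mul, ← Algebra.smul_def, ← Complex.coe_smul g ((Complex.I / 2 * (f : ℂ)) • _),
    smul_smul]
  congr 2
  push_cast
  ring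

/-- Disposes of the `σ^1` part of the Ricci scalar: `tr(GF) = 0`, and the second term is a multiple
of the antisymmetric form `F` evaluated twice on the vector `G k`. -/
theorem sum_mul_antisymm {G F B : Matrix (Fin n) (Fin n) ℝ} (hG : Gᵀ = G) (hF : Fᵀ = -F)
    (hB : B = (1 / 2 : ℝ) • (G * F)) (k : Fin n → ℝ) (c : ℝ) :
    ∑ l, ∑ ν, G l ν * (-(F l ν / c) + k l * ∑ μ, k μ * B μ ν) = 0 := by
  have h1 : ∑ l, ∑ ν, G l ν * (-(F l ν / c) + k l * ∑ μ, k μ * B μ ν) =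
      -(∑ l, ∑ ν, G l ν * F l ν) / c + k ⬝ᵥ (G *ᵥ (k ᵥ* B)) := by
    simp only [mul_add, Finset.sum_add_distrib, Matrix.mulVec, Matrix.vecMul, dotProduct,
      neg_div, Finset.sum_div]
    congr 1
    · simp only [← Finset.sum_neg_distrib, mul_neg, mul_div_assoc]
    · refine Finset.sum_congr rfl fun l _ => ?_
      rw [Finset.mul_sum]
      exact Finset.sum_congr rfl fun ν _ => by ring
  have h2 : k ᵥ* B = -((1 / 2 : ℝ) • (F *ᵥ (G *ᵥ k))) := by
    rw [← Matrix.mulVec_transpose, hB, Matrix.transpose_smul, Matrix.transpose_mul, hG, hF]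
    simp [Matrix.neg_mulVec, Matrix.smul_mulVec]
  have h3 : (G *ᵥ k) ⬝ᵥ (F *ᵥ (G *ᵥ k)) = 0 := by
    have h4 : (G *ᵥ k) ⬝ᵥ (F *ᵥ (G *ᵥ k)) = -((G *ᵥ k) ⬝ᵥ (F *ᵥ (G *ᵥ k))) := by
      conv_lhs => rw [Matrix.dotProduct_mulVec, dotProduct_comm, ← Matrix.mulVec_transpose, hF,
        Matrix.neg_mulVec, dotProduct_neg]
    linarith
  rw [h1, sum_mul_eq_trace, hF, Matrix.mul_neg, Matrix.trace_neg, trace_mul_antisymm hG hF, h2,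
    Matrix.dotProduct_mulVec, ← Matrix.mulVec_transpose, hG, dotProduct_neg, dotProduct_smul, h3]
  simp

theorem adapted_ricciScalar (Γ : Fin n → Fin n → Fin n → E n → ℝ) (B F : Fin n → Fin n → E n → ℝ)
    (k : Fin n → E n → ℝ) (h : ℝ) (ρ : E n → ℂ) (y : E n) (G : Matrix (Fin n) (Fin n) ℝ)
    (A : Fin n → ℝ)
    (hΓ : ∀ σ μ ν, DifferentiableAt ℝ (Γ σ μ ν) y) (hBd : ∀ μ ν, DifferentiableAt ℝ (B μ ν) y)
    (hkd : ∀ μ, DifferentiableAt ℝ (k μ) y)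
    (hdk : ∀ μ ν, pd μ (k ν) y - pd ν (k μ) y = F μ ν y / h)
    (hG : Gᵀ = G) (hF : ∀ μ ν, F ν μ y = -F μ ν y)
    (hB : ∀ μ ν, B μ ν y = 1 / 2 * ∑ α, G μ α * F α ν y) (hk : ∀ μ, k μ y = A μ / h) :
    ∑ r, ∑ f, ((adaptedInverse G h r f : ℝ) : ℂ) •
        ∑ p, (((1 - shiftMatrix fun μ => k μ y) p r : ℝ) : ℂ) •
          ∑ d, ∑ b, (((1 - shiftMatrix fun μ => k μ y) b d : ℝ) : ℂ) •
            liftMat (adaptedConn Γ B F k h ρ) y b p d f =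
      algebraMap ℝ M2 (-(1 / 2) * ∑ α, ∑ β, G α β * ricciOf Γ α β y
        + 1 / (8 * h) * ∑ μ, ∑ ν, ∑ α, ∑ β, G μ α * G ν β * F μ ν y * F α β y
        + 1 / (8 * h ^ 2) * ∑ μ, ∑ ν, G μ ν * (∑ α, ∑ β, G α β * A α * F β μ y) *
            (∑ α, ∑ β, G α β * A α * F β ν y)) + (2 * ρ y ^ 2 / h) • (1 : M2) := by
  have hFm : (Matrix.of fun μ ν => F μ ν y)ᵀ = -Matrix.of fun μ ν => F μ ν y := by
    ext μ ν; simp [hF ν μ]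
  have hBm : (Matrix.of fun μ ν => B μ ν y) = (1 / 2 : ℝ) • (G * Matrix.of fun μ ν => F μ ν y) := by
    ext μ ν; simp [hB, Matrix.mul_apply]
  rw [adapted_contraction]
  obtain ⟨z1, z2, z3, z4, z5, z6, z7⟩ := liftMat_adaptedConn_zero Γ B F k h ρ y
  -- The lift is antisymmetric on `dx^l ∧ s^1`, so these entries reduce to the computed ones.
  have hneg : ∀ l, liftMat (adaptedConn Γ B F k h ρ) y (Sum.inr 0) (Sum.inl l) =
      -liftMat (adaptedConn Γ B F k h ρ) y (Sum.inl l) (Sum.inr 0) := fun l => rfl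
  simp only [liftMat_adaptedConn_sx, z1, z2, z3, z4, z5, z6, z7]
  simp only [hneg, Matrix.neg_apply, Matrix.zero_apply, liftMat_adaptedConn_xx F h ρ hΓ hBd hkd,
    liftMat_adaptedConn_xs Γ F k h ρ hBd, liftMat_adaptedConn_ss, frame_sum_eq,
    liftMat_adaptedConn_trace, liftMat_adaptedConn_s₂s₂, real_frame_sum Γ B F k h y hdk]
  simp only [smul_algebraMap_add, smul_zero, sub_zero, add_zero, zero_add, Finset.sum_const_zero,
    Finset.sum_add_distrib, Finset.sum_sub_distrib, ← map_sum, ← Finset.sum_smul, ← Finset.mul_sum,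
    ← Complex.ofReal_sum]
  have hσ := sum_mul_antisymm hG hFm hBm (fun μ => k μ y) (2 * h)
  have htr : ∑ μ, B μ μ y = 0 := by
    have : (Matrix.of fun μ ν => B μ ν y).trace = 0 := by
      rw [hBm, Matrix.trace_smul, trace_mul_antisymm hG hFm, smul_zero]
    exact this
  have h1 := quadratic_contraction hG hFm hBm h
  have h2 := quartic_contraction hG hFm hBm fun μ => k μ y
  simp only [Matrix.of_apply] at hσ h1 h2
  rw [hσ, htr]
  have hw : ∀ μ, ∑ α, ∑ β, G α β * k α y * F β μ y =
      1 / h * ∑ α, ∑ β, G α β * A α * F β μ y := by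
    intro μ
    simp only [Finset.mul_sum, hk]
    exact Finset.sum_congr rfl fun _ _ => Finset.sum_congr rfl fun _ _ => by ring
  have hww : ∀ w : Fin n → ℝ, ∑ μ, ∑ ν, G μ ν * (1 / h * w μ) * (1 / h * w ν) =
      1 / h ^ 2 * ∑ μ, ∑ ν, G μ ν * w μ * w ν := by
    intro w
    simp only [Finset.mul_sum]
    exact Finset.sum_congr rfl fun _ _ => Finset.sum_congr rfl fun _ _ => by ring
  simp only [hw] at h2
  rw [hww fun μ => ∑ α, ∑ β, G α β * A α * F β μ y] at h2
  have hX : ∀ P Q R : Fin n → Fin n → ℝ, ∑ l, ∑ ν, G l ν * (-(1 / 2) * P l ν + Q l ν - 1 / 2 * R l ν)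
      = -(1 / 2) * ∑ l, ∑ ν, G l ν * P l ν + ∑ l, ∑ ν, G l ν * Q l ν
        - 1 / 2 * ∑ l, ∑ ν, G l ν * R l ν := by
    intro P Q R
    simp only [Finset.mul_sum, ← Finset.sum_add_distrib, ← Finset.sum_sub_distrib]
    exact Finset.sum_congr rfl fun _ _ => Finset.sum_congr rfl fun _ _ => by ring
  rw [hX, h2]
  simp only [Finset.sum_add_distrib, Finset.sum_sub_distrib, ← Finset.mul_sum] at h1
  rw [Complex.ofReal_zero, mul_zero, zero_smul, add_zero, sub_zero, Algebra.smul_def (1 / h)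
    (algebraMap ℝ M2 _), ← map_mul, ← map_add, sub_eq_add_neg, ← Complex.coe_smul, ← smul_neg,
    ← neg_smul, smul_smul]
  congr 2
  · linear_combination h1
  · push_cast
    ring

/-! ## The given connection in the adapted frame -/

theorem realMat_shiftMatrix_mul_apply (k : Fin n → ℝ) (X : FrameMat n) (c : Ix n) :
    (∀ μ, (realMat (shiftMatrix k) * X) (Sum.inl μ) c = 0) ∧
    (realMat (shiftMatrix k) * X) (Sum.inr 0) c = ∑ μ, k μ • X (Sum.inl μ) c ∧
    (realMat (shiftMatrix k) * X) (Sum.inr 1) c = 0 := by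
  refine ⟨fun μ => ?_, ?_, ?_⟩ <;> simp [realMat, shiftMatrix, Matrix.mul_apply]

theorem mul_realMat_shiftMatrix_apply (k : Fin n → ℝ) (X : FrameMat n) (b : Ix n) :
    (∀ ν, (X * realMat (shiftMatrix k)) b (Sum.inl ν) = k ν • X b (Sum.inr 0)) ∧
    (∀ i, (X * realMat (shiftMatrix k)) b (Sum.inr i) = 0) := by
  refine ⟨fun ν => ?_, fun i => ?_⟩ <;> simp [realMat, shiftMatrix, Matrix.mul_apply]

theorem conj_apply (k : Fin n → ℝ) (X : FrameMat n) :
    (∀ μ ν, ((1 - realMat (shiftMatrix k)) * X * (1 + realMat (shiftMatrix k)))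
      (Sum.inl μ) (Sum.inl ν) = X (Sum.inl μ) (Sum.inl ν) + k ν • X (Sum.inl μ) (Sum.inr 0)) ∧
    (∀ μ i, ((1 - realMat (shiftMatrix k)) * X * (1 + realMat (shiftMatrix k)))
      (Sum.inl μ) (Sum.inr i) = X (Sum.inl μ) (Sum.inr i)) ∧
    (∀ ν, ((1 - realMat (shiftMatrix k)) * X * (1 + realMat (shiftMatrix k)))
      (Sum.inr 0) (Sum.inl ν) = X (Sum.inr 0) (Sum.inl ν) + k ν • X (Sum.inr 0) (Sum.inr 0)
        - ∑ μ, k μ • (X (Sum.inl μ) (Sum.inl ν) + k ν • X (Sum.inl μ) (Sum.inr 0))) ∧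
    (∀ i, ((1 - realMat (shiftMatrix k)) * X * (1 + realMat (shiftMatrix k)))
      (Sum.inr 0) (Sum.inr i) = X (Sum.inr 0) (Sum.inr i) - ∑ μ, k μ • X (Sum.inl μ) (Sum.inr i)) ∧
    (∀ ν, ((1 - realMat (shiftMatrix k)) * X * (1 + realMat (shiftMatrix k)))
      (Sum.inr 1) (Sum.inl ν) = X (Sum.inr 1) (Sum.inl ν) + k ν • X (Sum.inr 1) (Sum.inr 0)) ∧
    (∀ i, ((1 - realMat (shiftMatrix k)) * X * (1 + realMat (shiftMatrix k)))
      (Sum.inr 1) (Sum.inr i) = X (Sum.inr 1) (Sum.inr i)) := by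
  have h1 : (1 - realMat (shiftMatrix k)) * X * (1 + realMat (shiftMatrix k)) =
      X + X * realMat (shiftMatrix k) - realMat (shiftMatrix k) *
        (X + X * realMat (shiftMatrix k)) := by noncomm_ring
  rw [h1]
  refine ⟨fun μ ν => ?_, fun μ i => ?_, fun ν => ?_, fun i => ?_, fun ν => ?_, fun i => ?_⟩ <;>
  simp [realMat_shiftMatrix_mul_apply, mul_realMat_shiftMatrix_apply]

/-- Without differentiability both sides are the default value `0`. This lets the change of frame be
an identity of functions on all of `E n`, including points outside the chart where nothing is known
to be smooth. -/
theorem deriv0_algebraMap_inl' (f : E n → ℝ) (y : E n) (μ : Fin n) :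
    deriv0 (fun z => algebraMap ℝ M2 (f z)) (Sum.inl μ) y = algebraMap ℝ M2 (pd μ f y) := by
  by_cases hf : DifferentiableAt ℝ f y
  · exact deriv0_algebraMap_inl hf μ
  · have h1 : ¬ DifferentiableAt ℝ (fun z => (algebraMap ℝ ℂ (f z))) y := fun h =>
      hf (Complex.reCLM.differentiableAt.comp y h)
    ext p q
    simp only [deriv0, Matrix.algebraMap_matrix_apply, Matrix.of_apply, pd]
    split_ifs
    · rw [fderiv_zero_of_not_differentiableAt h1, fderiv_zero_of_not_differentiableAt hf]
      simp
    · simp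

theorem pd_div_const (f : E n → ℝ) (c : ℝ) (μ : Fin n) (y : E n) :
    pd μ (fun z => f z / c) y = pd μ f y / c := by
  have h1 : (fun z => f z / c) = c⁻¹ • f := by
    funext z
    simp [div_eq_inv_mul]
  rw [pd, h1, fderiv_const_smul_field]
  simp [pd, div_eq_inv_mul]

theorem dMat_realMat_inl (X : E n → Matrix (Ix n) (Ix n) ℝ) (μ : Fin n) (y : E n) :
    dMat (fun z => realMat (X z)) (Sum.inl μ) y =
      realMat (Matrix.of fun b c => pd μ (fun z => X z b c) y) := by
  ext1 b c
  have h1 : ∀ r : ℝ, (r : ℂ) • (1 : M2) = algebraMap ℝ M2 r := fun r => by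
    rw [Complex.coe_smul, Algebra.algebraMap_eq_smul_one]
  simp only [dMat, realMat, Matrix.of_apply, h1, deriv0_algebraMap_inl']

section Connection

variable (g : E n → Matrix (Fin n) (Fin n) ℝ) (A : E n → Fin n → ℝ) (h : ℝ) (ρ : E n → ℂ)

theorem fieldStrength_antisymm (μ ν : Fin n) (y : E n) :
    fieldStrength A ν μ y = -fieldStrength A μ ν y := by
  simp [fieldStrength]

variable {g}

theorem tildeMetric_symm (hg : ∀ z μ ν, g z μ ν = g z ν μ) (z : E n) (μ ν : Fin n) :
    tildeMetric g A h z μ ν = tildeMetric g A h z ν μ := by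
  simp [tildeMetric, hg z μ ν, mul_comm]

theorem christoffel_symm {g : E n → Matrix (Fin n) (Fin n) ℝ} (hg : ∀ z μ ν, g z μ ν = g z ν μ)
    (σ μ ν : Fin n) (y : E n) : christoffel g σ μ ν y = christoffel g σ ν μ y := by
  simp only [christoffel]
  congr 1
  refine Finset.sum_congr rfl fun κ _ => ?_
  have h1 : ∀ a b c, pd a (fun z => g z b c) y = pd a (fun z => g z c b) y := by
    intro a b c
    congr 1
    funext z
    exact hg z b c
  rw [h1 ν κ μ, h1 μ ν κ, h1 κ μ ν]
  ring

theorem gam_symm (hg : ∀ z μ ν, g z μ ν = g z ν μ) (σ μ ν : Fin n) (y : E n) :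
    Gam g A h σ μ ν y = Gam g A h σ ν μ y := by
  simp only [Gam]
  rw [christoffel_symm (tildeMetric_symm A h hg)]
  congr 2
  exact Finset.sum_congr rfl fun κ _ => by ring

/-- The symbols `Γ` are symmetric in their lower indices, so they cancel from the antisymmetrized
covariant derivative. -/
theorem bf_eq (hg : ∀ z μ ν, g z μ ν = g z ν μ) (μ ν : Fin n) (y : E n) :
    Bf g A h μ ν y = 1 / 2 * ∑ α, (tildeMetric g A h y)⁻¹ μ α * fieldStrength A α ν y := by
  simp only [Bf, covA, fieldStrength]
  congr 1
  refine Finset.sum_congr rfl fun α _ => ?_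
  simp only [gam_symm A h hg _ ν α]
  ring

/-- The two terms in `B` are what `B^σ_α (dx^α ⊗ ω + ω ⊗ dx^α)` contributes to `dx ⊗ dx` on
substituting `ω = s^1 + h⁻¹ A`. -/
theorem neg_gam_eq (hg : ∀ z μ ν, g z μ ν = g z ν μ) (σ μ ν : Fin n) (y : E n) :
    -Gam g A h σ μ ν y = -christoffel (tildeMetric g A h) σ μ ν y +
      A y μ / h * Bf g A h σ ν y + A y ν / h * Bf g A h σ μ y := by
  simp only [Gam, bf_eq A h hg]
  rw [neg_add, add_assoc]
  congr 1
  simp only [Finset.mul_sum, ← Finset.sum_add_distrib, ← Finset.sum_neg_distrib]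
  refine Finset.sum_congr rfl fun κ _ => ?_
  rw [fieldStrength_antisymm A κ ν, fieldStrength_antisymm A κ μ]
  ring

theorem ofReal_apply (f : E n → ℝ) (y : E n) : ofReal f y = algebraMap ℝ M2 (f y) := by
  rw [ofReal, ofFun, Complex.coe_smul, Algebra.algebraMap_eq_smul_one]

theorem ef_apply (α : Fin n) (z : E n) :
    Ef g A h α z = (Complex.I * (A z α / h : ℝ)) • pauli 0 -
      ∑ μ, (A z μ / h) • algebraMap ℝ M2 (Bf g A h μ α z) := by
  have h1 : ∀ μ, (A z μ / h) • algebraMap ℝ M2 (Bf g A h μ α z) =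
      algebraMap ℝ M2 (1 / h * (A z μ * Bf g A h μ α z)) := by
    intro μ
    rw [Algebra.smul_def, ← map_mul]
    congr 1
    ring
  simp only [h1, ← map_sum, ← Finset.mul_sum]
  simp only [Ef, Pi.add_apply, Pi.mul_apply, ofReal_apply, ofFun, ofM2, smul_mul_assoc, one_mul,
    neg_mul, map_neg]
  rw [neg_add_eq_sub]
  congr 2
  push_cast
  ring

/-- Written in the shape of the `s^1, dx^ν` entry of the gauge transform; the last term is the
inhomogeneous part `∂_l K`. It splits `∂_l A_ν` into its symmetric part, contained in `D`, and `½
F_{lν}`. -/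
theorem df_apply (hg : ∀ z μ ν, g z μ ν = g z ν μ) (l ν : Fin n) (z : E n) :
    Df g A h l ν z = algebraMap ℝ M2 (fieldStrength A l ν z / (2 * h)) +
      (A z ν / h) • (Complex.I * (A z l / h : ℝ)) • pauli 0 -
      ∑ μ, (A z μ / h) • (algebraMap ℝ M2 (-christoffel (tildeMetric g A h) μ l ν z +
        A z l / h * Bf g A h μ ν z) + (A z ν / h) • algebraMap ℝ M2 (Bf g A h μ l z)) -
      algebraMap ℝ M2 (pd l (fun z => A z ν) z / h) := by
  have h1 : ∀ μ, (A z μ / h) • (algebraMap ℝ M2 (-christoffel (tildeMetric g A h) μ l ν z +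
        A z l / h * Bf g A h μ ν z) + (A z ν / h) • algebraMap ℝ M2 (Bf g A h μ l z)) =
      algebraMap ℝ M2 (1 / h * (-Gam g A h μ l ν z * A z μ)) := by
    intro μ
    rw [Algebra.smul_def, Algebra.smul_def, ← map_mul, ← map_add, ← map_mul, neg_gam_eq A h hg]
    congr 1
    ring
  have h2 : (A z ν / h) • (Complex.I * (A z l / h : ℝ)) • pauli 0 =
      (Complex.I / (h : ℂ) ^ 2 * (A z l : ℂ) * (A z ν : ℂ)) • pauli 0 := by
    rw [← Complex.coe_smul, smul_smul]
    congr 1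
    push_cast
    ring
  simp only [h1, h2, ← map_sum, ← Finset.mul_sum]
  simp only [Df, Pi.add_apply, Pi.mul_apply, ofReal_apply, ofFun, ofM2, smul_mul_assoc, one_mul]
  rw [add_sub_right_comm, add_sub_right_comm, ← map_sub, ← map_sub]
  congr 2
  simp only [covA, gam_symm A h hg _ ν l, fieldStrength, neg_mul, Finset.sum_neg_distrib]
  ring

/-- The change of frame `ω = s^1 + h⁻¹ A`. -/
def frameShift (A : E n → Fin n → ℝ) (h : ℝ) (z : E n) : FrameMat n :=
  realMat (shiftMatrix fun μ => A z μ / h)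

theorem dMat_frameShift (l : Fin n) (y : E n) :
    dMat (frameShift A h) (Sum.inl l) y =
      realMat (shiftMatrix fun ν => pd l (fun z => A z ν) y / h) := by
  have h1 : frameShift A h = fun z => realMat (shiftMatrix fun μ => A z μ / h) := rfl
  rw [h1, dMat_realMat_inl]
  congr 1
  ext b c
  rcases b with μ | i <;> rcases c with ν | j
  · simp [shiftMatrix, pd]
  · simp [shiftMatrix, pd]
  · fin_cases i
    · simp [shiftMatrix, pd_div_const]
    · simp [shiftMatrix, pd]
  · simp [shiftMatrix, pd]

/-- There is no inhomogeneous term along `s^i`: the entries of `K` are central, so `∂_i` kills them.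
-/
theorem connMat_inr_eq (i : Fin 2) :
    connMat (connection g A h ρ) (Sum.inr i) = fun z => (1 - frameShift A h z) *
      adaptedConn (christoffel (tildeMetric g A h)) (Bf g A h) (fieldStrength A)
        (fun μ z => A z μ / h) h ρ (Sum.inr i) z * (1 + frameShift A h z) := by
  funext z
  obtain ⟨c1, c2, c3, c4, c5, c6⟩ := conj_apply (fun μ => A z μ / h)
    (adaptedConn (christoffel (tildeMetric g A h)) (Bf g A h) (fieldStrength A)
        (fun μ z => A z μ / h) h ρ (Sum.inr i) z)
  ext1 b c
  rcases b with μ | b <;> rcases c with ν | c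
  · rw [frameShift, c1]
    fin_cases i <;> simp [connMat, connection, adaptedConn, ofReal_apply]
  · rw [frameShift, c2]
    fin_cases i <;> simp [connMat, connection, adaptedConn]
  · fin_cases b
    · refine Eq.trans ?_ (c3 ν).symm
      fin_cases i
      · simp [connMat, connection, adaptedConn, ef_apply]
        rw [← Complex.coe_smul, smul_smul]
        congr 1
        push_cast
        ring
      · simp [connMat, connection, adaptedConn]
    · refine Eq.trans ?_ (c5 ν).symm
      fin_cases i <;> simp [connMat, connection, adaptedConn]
  · fin_cases b
    · refine Eq.trans ?_ (c4 c).symm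
      fin_cases i <;> fin_cases c <;> simp [connMat, connection, adaptedConn, ofM2]
    · refine Eq.trans ?_ (c6 c).symm
      fin_cases i <;> fin_cases c <;> simp [connMat, connection, adaptedConn, ofM2, ofFun]

theorem connMat_inl_eq (hg : ∀ z μ ν, g z μ ν = g z ν μ) (l : Fin n) :
    connMat (connection g A h ρ) (Sum.inl l) = fun z => (1 - frameShift A h z) *
      adaptedConn (christoffel (tildeMetric g A h)) (Bf g A h) (fieldStrength A)
        (fun μ z => A z μ / h) h ρ (Sum.inl l) z * (1 + frameShift A h z) -
          dMat (frameShift A h) (Sum.inl l) z := by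
  funext z
  obtain ⟨c1, c2, c3, c4, c5, c6⟩ := conj_apply (fun μ => A z μ / h)
    (adaptedConn (christoffel (tildeMetric g A h)) (Bf g A h) (fieldStrength A)
        (fun μ z => A z μ / h) h ρ (Sum.inl l) z)
  rw [dMat_frameShift]
  ext1 b c
  rw [Matrix.sub_apply, frameShift]
  rcases b with μ | b <;> rcases c with ν | c
  · rw [c1]
    simp only [connMat, connection, adaptedConn, ofReal_apply, realMat, shiftMatrix,
      Matrix.of_apply, Matrix.fromBlocks_apply₁₁, Matrix.fromBlocks_apply₁₂, Matrix.zero_apply,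
      Matrix.cons_val_zero, Complex.ofReal_zero, zero_smul, sub_zero]
    rw [Algebra.smul_def, ← map_mul, ← map_add, neg_gam_eq A h hg]
  · rw [c2]
    fin_cases c <;> simp [connMat, connection, adaptedConn, realMat, shiftMatrix, ofReal_apply]
  · fin_cases b
    · refine Eq.trans ?_ (congrArg (· - _) (c3 ν).symm)
      refine (df_apply A h hg l ν z).trans ?_
      simp [adaptedConn, realMat, shiftMatrix, Algebra.algebraMap_eq_smul_one]
    · refine Eq.trans ?_ (congrArg (· - _) (c5 ν).symm)
      simp [connMat, connection, adaptedConn, realMat, shiftMatrix]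
  · fin_cases b
    · refine Eq.trans ?_ (congrArg (· - _) (c4 c).symm)
      fin_cases c
      · simp [connMat, connection, adaptedConn, ef_apply, realMat, shiftMatrix]
      · simp [connMat, connection, adaptedConn, realMat, shiftMatrix]
    · refine Eq.trans ?_ (congrArg (· - _) (c6 c).symm)
      fin_cases c <;> simp [connMat, connection, adaptedConn, realMat, shiftMatrix]

end Connection

/-! ## The inverse of the quantum metric -/

theorem shiftMatrix_mul_shiftMatrix (k k' : Fin n → ℝ) : shiftMatrix k * shiftMatrix k' = 0 := by
  rw [shiftMatrix, shiftMatrix, Matrix.fromBlocks_multiply]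
  simp

/-- Completing the square in `s^1`, as a congruence of matrices. -/
theorem metricMatrix_eq (g : E n → Matrix (Fin n) (Fin n) ℝ) (A : E n → Fin n → ℝ) {h : ℝ}
    (hh : h ≠ 0) (y : E n) :
    metricMatrix g A h y = (1 + shiftMatrix fun μ => A y μ / h)ᵀ *
      Matrix.fromBlocks (tildeMetric g A h y) 0 0 !![h, 0; 0, -h] *
      (1 + shiftMatrix fun μ => A y μ / h) := by
  rw [shiftMatrix, ← Matrix.fromBlocks_one, Matrix.fromBlocks_add, Matrix.fromBlocks_transpose,
    Matrix.fromBlocks_multiply, Matrix.fromBlocks_multiply, metricMatrix]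
  congr 1
  · ext μ ν
    simp [tildeMetric, Matrix.mul_apply]
    field_simp
    ring
  · ext μ i
    fin_cases i <;> simp [Matrix.mul_apply, hh]
  · ext i μ
    fin_cases i
    · simp [Matrix.vecHead]
      field_simp
    · simp [Matrix.vecHead, Matrix.vecTail]
  · simp

theorem metricMatrix_mul_eq_one (g : E n → Matrix (Fin n) (Fin n) ℝ) (A : E n → Fin n → ℝ) {h : ℝ}
    (hh : h ≠ 0) (y : E n) (hdet : (tildeMetric g A h y).det ≠ 0) :
    metricMatrix g A h y * ((1 - shiftMatrix fun μ => A y μ / h) *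
      adaptedInverse (tildeMetric g A h y)⁻¹ h * (1 - shiftMatrix fun μ => A y μ / h)ᵀ) = 1 := by
  have h1 : (1 + shiftMatrix fun μ => A y μ / h) * (1 - shiftMatrix fun μ => A y μ / h) = 1 := by
    rw [add_mul, mul_sub, mul_sub, shiftMatrix_mul_shiftMatrix]
    simp
  have h2 : Matrix.fromBlocks (tildeMetric g A h y) 0 0 !![h, 0; 0, -h] *
      adaptedInverse (tildeMetric g A h y)⁻¹ h = 1 := by
    rw [adaptedInverse, Matrix.fromBlocks_multiply, ← Matrix.fromBlocks_one,
      Matrix.mul_nonsing_inv _ (isUnit_iff_ne_zero.2 hdet)]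
    congr 1
    · simp
    · simp
    · simp
    · ext i j
      fin_cases i <;> fin_cases j <;> simp [hh]
  have h3 : (1 + shiftMatrix fun μ => A y μ / h)ᵀ * (1 - shiftMatrix fun μ => A y μ / h)ᵀ = 1 := by
    rw [← Matrix.transpose_mul, mul_eq_one_comm.1 h1, Matrix.transpose_one]
  rw [metricMatrix_eq g A hh]
  generalize 1 + (shiftMatrix fun μ => A y μ / h) = u at *
  generalize 1 - (shiftMatrix fun μ => A y μ / h) = v at *
  generalize Matrix.fromBlocks (tildeMetric g A h y) 0 0 !![h, 0; 0, -h] = D at *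
  generalize adaptedInverse (tildeMetric g A h y)⁻¹ h = D' at *
  calc uᵀ * D * u * (v * D' * vᵀ) = uᵀ * (D * (u * v) * D') * vᵀ := by
        simp only [Matrix.mul_assoc]
    _ = 1 := by rw [h1, mul_one, h2, mul_one, h3]

theorem inv_metricMatrix_mul (g : E n → Matrix (Fin n) (Fin n) ℝ) (A : E n → Fin n → ℝ) {h : ℝ}
    (hh : h ≠ 0) (y : E n) (hdet : (tildeMetric g A h y).det ≠ 0) :
    (metricMatrix g A h y)⁻¹ * (1 + shiftMatrix fun μ => A y μ / h)ᵀ =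
      (1 - shiftMatrix fun μ => A y μ / h) * adaptedInverse (tildeMetric g A h y)⁻¹ h := by
  have h1 : (1 + shiftMatrix fun μ => A y μ / h) * (1 - shiftMatrix fun μ => A y μ / h) = 1 := by
    rw [add_mul, mul_sub, mul_sub, shiftMatrix_mul_shiftMatrix]
    simp
  rw [Matrix.inv_eq_right_inv (metricMatrix_mul_eq_one g A hh y hdet), Matrix.mul_assoc,
    ← Matrix.transpose_mul, h1, Matrix.transpose_one, mul_one]

theorem transpose_metricMatrix {g : E n → Matrix (Fin n) (Fin n) ℝ}
    (hg : ∀ z μ ν, g z μ ν = g z ν μ) (A : E n → Fin n → ℝ) (h : ℝ) (y : E n) :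
    (metricMatrix g A h y)ᵀ = metricMatrix g A h y := by
  rw [metricMatrix, Matrix.fromBlocks_transpose]
  congr 1
  · ext μ ν; exact hg y ν μ
  · ext i j; fin_cases i <;> fin_cases j <;> rfl

/-! ## Differentiability of the components -/

theorem contDiffAt_det {m : Type*} [Fintype m] [DecidableEq m] {X : E n → Matrix m m ℝ} {y : E n}
    (hX : ∀ i j, ContDiffAt ℝ ∞ (fun z => X z i j) y) : ContDiffAt ℝ ∞ (fun z => (X z).det) y := by
  simp only [Matrix.det_apply]
  exact ContDiffAt.sum fun σ _ => (contDiffAt_prod fun i _ => hX _ _).const_smul _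

theorem contDiffAt_inv {X : E n → Matrix (Fin n) (Fin n) ℝ} {y : E n}
    (hX : ∀ i j, ContDiffAt ℝ ∞ (fun z => X z i j) y) (hdet : (X y).det ≠ 0) (i j : Fin n) :
    ContDiffAt ℝ ∞ (fun z => (X z)⁻¹ i j) y := by
  simp only [Matrix.inv_def, Ring.inverse_eq_inv', Matrix.smul_apply, smul_eq_mul,
    Matrix.adjugate_apply]
  refine ((contDiffAt_det hX).inv hdet).mul (contDiffAt_det fun a b => ?_)
  -- The adjugate entry is the determinant of `X` with row `j` replaced by a constant vector; the
  -- other rows are unchanged.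
  by_cases h : a = j
  · subst h
    simpa using contDiffAt_const
  · simpa [Matrix.updateRow_ne h] using hX a b

theorem contDiffAt_pd {f : E n → ℝ} {y : E n} (hf : ContDiffAt ℝ ∞ f y) (μ : Fin n) :
    ContDiffAt ℝ ∞ (pd μ f) y :=
  (hf.fderiv_right (m := ∞) (by simp)).clm_apply contDiffAt_const

theorem pd_comm {f : E n → ℝ} {y : E n} (hf : ContDiffAt ℝ ∞ f y) (μ ν : Fin n) :
    pd μ (pd ν f) y = pd ν (pd μ f) y := by
  have h1 : IsSymmSndFDerivAt ℝ f y := hf.isSymmSndFDerivAt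
    (by rw [minSmoothness_of_isRCLikeNormedField]; exact WithTop.coe_le_coe.2 le_top)
  have hd : DifferentiableAt ℝ (fderiv ℝ f) y :=
    (hf.fderiv_right (m := ∞) (by simp)).differentiableAt (by simp)
  have h2 : ∀ a b : Fin n, pd a (pd b f) y =
      fderiv ℝ (fderiv ℝ f) y (EuclideanSpace.single a 1) (EuclideanSpace.single b 1) := by
    intro a b
    have h3 : pd b f = fun z => fderiv ℝ f z (EuclideanSpace.single b 1) := rfl
    rw [h3, pd, fderiv_clm_apply hd (differentiableAt_const _)]
    simp
  rw [h2, h2]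
  exact h1.eq _ _

theorem contDiffAt_christoffel {g : E n → Matrix (Fin n) (Fin n) ℝ} {y : E n}
    (hg : ∀ i j, ContDiffAt ℝ ∞ (fun z => g z i j) y) (hdet : (g y).det ≠ 0) (σ μ ν : Fin n) :
    ContDiffAt ℝ ∞ (christoffel g σ μ ν) y :=
  contDiffAt_const.mul (ContDiffAt.sum fun κ _ => (contDiffAt_inv hg hdet σ κ).mul
    (((contDiffAt_pd (hg κ μ) ν).add (contDiffAt_pd (hg ν κ) μ)).sub (contDiffAt_pd (hg μ ν) κ)))

theorem contDiffAt_fieldStrength {A : E n → Fin n → ℝ} {y : E n}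
    (hA : ∀ i, ContDiffAt ℝ ∞ (fun z => A z i) y) (μ ν : Fin n) :
    ContDiffAt ℝ ∞ (fieldStrength A μ ν) y :=
  (contDiffAt_pd (hA ν) μ).sub (contDiffAt_pd (hA μ) ν)

theorem differentiableAt_div_const {f : E n → ℝ} {y : E n} (hf : DifferentiableAt ℝ f y) (c : ℝ) :
    DifferentiableAt ℝ (fun z => f z / c) y := by
  simpa only [div_eq_mul_inv] using hf.mul_const c⁻¹

theorem differentiableAt_algebraMap_apply {f : E n → ℝ} {y : E n} (hf : DifferentiableAt ℝ f y)
    (p q : Fin 2) : DifferentiableAt ℝ (fun z => algebraMap ℝ M2 (f z) p q) y := by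
  simp only [Matrix.algebraMap_matrix_apply]
  split_ifs
  · exact Complex.ofRealCLM.differentiableAt.comp y hf
  · exact differentiableAt_const _

theorem diffMatAt_realMat {X : E n → Matrix (Ix n) (Ix n) ℝ} {y : E n}
    (hX : ∀ b c, DifferentiableAt ℝ (fun z => X z b c) y) :
    DiffMatAt (fun z => realMat (X z)) y := by
  intro b c p q
  simp only [realMat, Matrix.of_apply, Matrix.smul_apply, smul_eq_mul]
  exact (Complex.ofRealCLM.differentiableAt.comp y (hX b c)).mul_const _

theorem diffMatAt_shiftMatrix {k : Fin n → E n → ℝ} {y : E n}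
    (hk : ∀ μ, DifferentiableAt ℝ (k μ) y) :
    DiffMatAt (fun z => realMat (shiftMatrix fun μ => k μ z)) y := by
  refine diffMatAt_realMat fun b c => ?_
  rcases b with μ | i <;> rcases c with ν | j
  · simp [shiftMatrix]
  · simp [shiftMatrix]
  · fin_cases i
    · simpa [shiftMatrix] using hk ν
    · simp [shiftMatrix]
  · simp [shiftMatrix]

theorem diffMatAt_adaptedConn {Γ : Fin n → Fin n → Fin n → E n → ℝ} {B F : Fin n → Fin n → E n → ℝ}
    {k : Fin n → E n → ℝ} (h : ℝ) {ρ : E n → ℂ} {y : E n}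
    (hΓ : ∀ σ μ ν, DifferentiableAt ℝ (Γ σ μ ν) y) (hB : ∀ μ ν, DifferentiableAt ℝ (B μ ν) y)
    (hF : ∀ μ ν, DifferentiableAt ℝ (F μ ν) y) (hk : ∀ μ, DifferentiableAt ℝ (k μ) y)
    (hρ : DifferentiableAt ℝ ρ y) (a : Ix n) : DiffMatAt (adaptedConn Γ B F k h ρ a) y := by
  intro b c p q
  have hk' : ∀ μ, DifferentiableAt ℝ (fun z => (k μ z : ℂ)) y := fun μ =>
    Complex.ofRealCLM.differentiableAt.comp y (hk μ)
  rcases a with l | i <;> rcases b with μ | b <;> rcases c with ν | c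
  · exact differentiableAt_algebraMap_apply (((hΓ μ l ν).neg).add ((hk l).mul (hB μ ν))) p q
  · fin_cases c
    · exact differentiableAt_algebraMap_apply (hB μ l) p q
    · exact differentiableAt_const _
  · fin_cases b
    · exact differentiableAt_algebraMap_apply (differentiableAt_div_const (hF l ν) _) p q
    · exact differentiableAt_const _
  · fin_cases b <;> fin_cases c
    · exact ((differentiableAt_const _).mul (hk' l)).mul_const _
    all_goals exact differentiableAt_const _
  · fin_cases i
    · exact differentiableAt_algebraMap_apply (hB μ ν) p q
    · exact differentiableAt_const _
  · exact differentiableAt_const _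
  · exact differentiableAt_const _
  · fin_cases i <;> fin_cases b <;> fin_cases c
    any_goals exact differentiableAt_const _
    exact ((differentiableAt_const _).mul hρ).mul_const _

/-! ## The Ricci scalar of the product geometry -/

theorem productRicciScalar_apply (g : E n → Matrix (Fin n) (Fin n) ℝ) (A : E n → Fin n → ℝ) {h : ℝ}
    (hh : h ≠ 0) (ρ : E n → ℂ) (y : E n) (hg : ∀ z μ ν, g z μ ν = g z ν μ)
    (hgd : ∀ μ ν, ContDiffAt ℝ ∞ (fun z => g z μ ν) y)
    (hA : ∀ μ, ContDiffAt ℝ ∞ (fun z => A z μ) y) (hρ : DifferentiableAt ℝ ρ y)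
    (hdet : (tildeMetric g A h y).det ≠ 0) :
    productRicciScalar g A h ρ y =
      algebraMap ℝ M2 (-(1 / 2) * scalarCurvature (tildeMetric g A h) y
        + 1 / (8 * h) * normSq₂ (tildeMetric g A h) (fieldStrength A) y
        + 1 / (8 * h ^ 2) * normSq₁ (tildeMetric g A h) (contractAF (tildeMetric g A h) A) y)
      + (2 * ρ y ^ 2 / h) • (1 : M2) := by
  have hgt : ∀ μ ν, ContDiffAt ℝ ∞ (fun z => tildeMetric g A h z μ ν) y := fun μ ν =>
    (hgd μ ν).sub (((hA μ).mul (hA ν)).div_const h)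
  have hΓ : ∀ σ μ ν, DifferentiableAt ℝ (christoffel (tildeMetric g A h) σ μ ν) y := fun σ μ ν =>
    (contDiffAt_christoffel hgt hdet σ μ ν).differentiableAt (by simp)
  have hF : ∀ μ ν, DifferentiableAt ℝ (fieldStrength A μ ν) y := fun μ ν =>
    (contDiffAt_fieldStrength hA μ ν).differentiableAt (by simp)
  have hB : ∀ μ ν, DifferentiableAt ℝ (Bf g A h μ ν) y := by
    intro μ ν
    have h1 : Bf g A h μ ν = fun z =>
        1 / 2 * ∑ α, (tildeMetric g A h z)⁻¹ μ α * fieldStrength A α ν z := by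
      funext z
      exact bf_eq A h hg μ ν z
    rw [h1]
    exact (DifferentiableAt.fun_sum fun α _ =>
      ((contDiffAt_inv hgt hdet μ α).differentiableAt (by simp)).mul (hF α ν)).const_mul _
  have hk : ∀ μ, DifferentiableAt ℝ (fun z => A z μ / h) y := fun μ =>
    differentiableAt_div_const ((hA μ).differentiableAt (by simp)) h
  have hpd : ∀ l μ, DifferentiableAt ℝ (fun z => pd l (fun z => A z μ) z / h) y := fun l μ =>
    differentiableAt_div_const ((contDiffAt_pd (hA μ) l).differentiableAt (by simp)) h
  have hdK : ∀ l, dMat (frameShift A h) (Sum.inl l) = fun z =>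
      realMat (shiftMatrix fun ν => pd l (fun z => A z ν) z / h) := fun l =>
    funext fun z => dMat_frameShift A h l z
  have hmul : ∀ k k' : Fin n → ℝ, realMat (shiftMatrix k) * realMat (shiftMatrix k') = 0 :=
    fun k k' => by rw [realMat_mul, shiftMatrix_mul_shiftMatrix, realMat_zero]
  have hsymm : ∀ μ ν, dMat (dMat (frameShift A h) (Sum.inl ν)) (Sum.inl μ) y =
      dMat (dMat (frameShift A h) (Sum.inl μ)) (Sum.inl ν) y := by
    intro μ ν
    rw [hdK, hdK, dMat_realMat_inl, dMat_realMat_inl]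
    congr 1
    ext b c
    rcases b with a | i <;> rcases c with b | j
    · simp [shiftMatrix, pd]
    · simp [shiftMatrix, pd]
    · fin_cases i
      · simpa [shiftMatrix, pd_div_const] using
          congrArg (· / h) (pd_comm (hA b) μ ν)
      · simp [shiftMatrix, pd]
    · simp [shiftMatrix, pd]
  have hgauge := liftMat_eq_of_gauge
    (N := connMat (connection g A h ρ)) (K := frameShift A h) (y := y)
    (diffMatAt_adaptedConn h hΓ hB hF hk hρ) (diffMatAt_shiftMatrix hk)
    (fun μ => by rw [hdK]; exact diffMatAt_shiftMatrix (hpd μ))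
    (connMat_inl_eq A h ρ hg) (connMat_inr_eq A h ρ) (hmul _ _)
    (fun μ => by rw [dMat_frameShift]; exact hmul _ _)
    (fun μ => by rw [dMat_frameShift]; exact hmul _ _)
    (fun μ ν => by rw [dMat_frameShift, dMat_frameShift]; exact hmul _ _) hsymm
    (fun i => pauliScalar_mul_realMat i _)
    (fun i μ => by rw [dMat_frameShift]; exact pauliScalar_mul_realMat i _)
  have hGP : (metricMatrix g A h y)ᵀ * (metricMatrix g A h y)⁻¹ = 1 := by
    rw [transpose_metricMatrix hg, Matrix.inv_eq_right_inv (metricMatrix_mul_eq_one g A hh y hdet)]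
    exact metricMatrix_mul_eq_one g A hh y hdet
  have h1 := ricciScalar_apply (connection g A h ρ) (metricMatrix g A h)
    (fun z => (metricMatrix g A h z)⁻¹) y hGP
  have hGi : ((tildeMetric g A h y)⁻¹)ᵀ = (tildeMetric g A h y)⁻¹ := by
    rw [Matrix.transpose_nonsing_inv]
    congr 1
    ext μ ν
    exact tildeMetric_symm A h hg y ν μ
  refine h1.trans ?_
  simp only [hgauge, frameShift]
  rw [sum_smul_conj _ _ _ _ (inv_metricMatrix_mul g A hh y hdet)]
  refine (adapted_ricciScalar _ _ _ (fun μ z => A z μ / h) h ρ y (tildeMetric g A h y)⁻¹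
    (A y) hΓ hB hk (fun μ ν => ?_) hGi (fun μ ν => fieldStrength_antisymm A μ ν y)
    (fun μ ν => bf_eq A h hg μ ν y) fun μ => rfl).trans ?_
  · rw [pd_div_const, pd_div_const, fieldStrength, sub_div]
  · rfl

end QKK

end

/-! ### The theorem on the manifold. -/

theorem mainTheorem3 {n : ℕ} {M : Type*} [TopologicalSpace M]
    [ChartedSpace (QKK.E n) M] [IsManifold (𝓡 n) ∞ M]
    (g : QKK.Metric n M) (A : QKK.OneForm n M) (h : ℝ) (hh : h ≠ 0)
    (htilde : ∀ x : M, (QKK.tildeForm g A h x).Nondegenerate)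
    (ρ : M → ℂ) (hρsmooth : ContMDiff (𝓡 n) 𝓘(ℝ, ℂ) ∞ ρ)
    (hρimag : ∀ x : M, (starRingEnd ℂ) (ρ x) = -ρ x) (hρ : ∀ x : M, ρ x ≠ 0)
    (e : OpenPartialHomeomorph M (QKK.E n)) (he : e ∈ IsManifold.maximalAtlas (𝓡 n) ∞ M)
    (x : M) (hx : x ∈ e.source) :
    QKK.productRicciScalar (g.comp e) (A.comp e) h (fun y => ρ (e.symm y)) (e x) =
      (((-(1 / 2) * QKK.scalarCurvature (QKK.tildeMetric (g.comp e) (A.comp e) h) (e x) : ℝ) : ℂ)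
        + 2 * ρ x ^ 2 / (h : ℂ)
        + ((1 / (8 * h) * QKK.normSq₂ (QKK.tildeMetric (g.comp e) (A.comp e) h)
            (QKK.fieldStrength (A.comp e)) (e x) : ℝ) : ℂ)
        + ((1 / (8 * h ^ 2) * QKK.normSq₁ (QKK.tildeMetric (g.comp e) (A.comp e) h)
            (QKK.contractAF (QKK.tildeMetric (g.comp e) (A.comp e) h) (A.comp e)) (e x) : ℝ) : ℂ))
      • (1 : QKK.M2) := by
  have hy := e.map_source hx
  rw [QKK.productRicciScalar_apply (g.comp e) (A.comp e) hh (fun y => ρ (e.symm y)) (e x)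
    (fun z μ ν => g.symm _ _ _) (QKK.contDiffAt_metric_comp g he hy)
    (QKK.contDiffAt_oneForm_comp A he hy) (QKK.differentiableAt_comp_chart_symm hρsmooth he hy)
    (QKK.det_tildeMetric_ne_zero g A h htilde he hy), Algebra.algebraMap_eq_smul_one,
    ← Complex.coe_smul, ← add_smul, e.left_inv hx]
  congr 1
  push_cast
  ring
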